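/- For $n\in\mathbb{N}=\{0,1,2,\dots\}$ and $\lambda\in\mathbb{C}$ let $$C_n^\lambda(s)=\sum_{k=0}^{\lfloor n/2\rfloor}\frac{(-1)^k(\lambda)_{n-k}}{k!\,(n-2k)!}(2s)^{n-2k},\qquad (\lambda)_j=\lambda(\lambda+1)\cdots(\lambda+j-1),$$ be the Gegenbauer polynomial, and put $$v_n^\lambda=\frac{2^{1-2\lambda}\,\pi\,\Gamma(n+2\lambda)}{n!\,(n+\lambda)\,\Gamma(\lambda)^2},$$ $$b^{\lambda,\mu,\nu}_{\ell,m}=\frac{(-1)^m(\lambda+\ell)(\mu+m)\,\Gamma(\lambda+\mu+2\nu+1)\,\Gamma(\lambda)\,\Gamma(\mu)\,\Gamma(2\nu+1)}{2^{2\nu}\prod_{\delta,\eta\in\{\pm1\}}\Gamma\left(\nu+1+\frac{\lambda+\mu}{2}+\delta\frac{\lambda+\ell}{2}+\eta\frac{\mu+m}{2}\right)},$$ where $1/\Gamma$ is understood to vanish at the poles of $\Gamma$. For real $\lambda>-\frac12$, $\lambda\neq0$, the number $v_n^\lambda$ is the squared norm of the Gegenbauer polynomial: $$\int_{-1}^1|C_n^\lambda(x)|^2(1-x^2)^{\lambda-\frac12}\,dx=v_n^\lambda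 .$$ Let $\varepsilon\in\{0,1\}$, $\ell,m\in\mathbb{N}$ and $\lambda,\mu,\nu\in\mathbb{C}$ with $\operatorname{Re}\lambda,\operatorname{Re}\mu>-\frac12$ and $\operatorname{Re}\nu>0$. Then the double integral below converges absolutely and $$\int_{-1}^1\int_{-1}^1|s-t|^{2\nu}\operatorname{sgn}^\varepsilon(s-t)(1-s^2)^{\lambda-\frac12}(1-t^2)^{\mu-\frac12}C_\ell^\lambda(s)\,C_m^\mu(t)\,ds\,dt=\tfrac12\left(1+(-1)^{\ell+m+\varepsilon}\right)b^{\lambda,\mu,\nu}_{\ell,m}\,v_\ell^\lambda\,v_m^\mu .$$ When $\lambda=0$ or $\mu=0$, where individual factors of the right-hand side have poles, the right-hand side is understood as its limit along $(\lambda',\mu')\to(\lambda,\mu)$ with $\lambda',\mu'\neq0$ (this limit exists and equals the left-hand side). -/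

import Mathlib

open scoped Topology

noncomputable section

/-- The Gegenbauer (ultraspherical) polynomial `C_n^lam` of degree `n` with complex parameter `lam`:
`∑_{k ≤ n/2} (-1)^k (lam)_{n-k} / (k! (n-2k)!) (2X)^{n-2k}`, where `(x)_j` is the rising
factorial `x (x+1) ⋯ (x+j-1)`. -/
def gegenbauerC (lam : ℂ) (n : ℕ) : Polynomial ℂ :=
  ∑ k ∈ Finset.range (n / 2 + 1),
    Polynomial.C ((-1 : ℂ) ^ k * (ascPochhammer ℂ (n - k)).eval lam /
        ((k.factorial : ℂ) * ((n - 2 * k).factorial : ℂ))) *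
      (2 * Polynomial.X) ^ (n - 2 * k)

/-- The constant `b^{lam,mu,nu}_{l,m}`. `Complex.Gamma` is `0` at the poles of the Gamma function and
`x / 0 = 0`, so a pole in the denominator gives the value `0`, in accordance with the convention
that `1 / Γ` vanishes there. -/
def coeffB (lam mu nu : ℂ) (l m : ℕ) : ℂ :=
  ((-1 : ℂ) ^ m * (lam + l) * (mu + m) * Complex.Gamma (lam + mu + 2 * nu + 1) *
      Complex.Gamma lam * Complex.Gamma mu * Complex.Gamma (2 * nu + 1)) /
    ((2 : ℂ) ^ (2 * nu) *
      ∏ δ ∈ ({1, -1} : Finset ℤ), ∏ η ∈ ({1, -1} : Finset ℤ),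
        Complex.Gamma (nu + 1 + (lam + mu) / 2 + δ * ((lam + l) / 2) + η * ((mu + m) / 2)))

/-- The constant `v_n^lam = 2^{1-2lam} π Γ(n+2lam) / (n! (n+lam) Γ(lam)^2)`, a meromorphic function of
the complex parameter `lam`. -/
def gegenbauerV (lam : ℂ) (n : ℕ) : ℂ :=
  ((2 : ℂ) ^ (1 - 2 * lam) * (Real.pi : ℂ) * Complex.Gamma (n + 2 * lam)) /
    ((n.factorial : ℂ) * (n + lam) * Complex.Gamma lam ^ 2)

/-- The function
`|s-t|^{2nu} sgn^ε(s-t) (1-s²)^{lam-1/2} (1-t²)^{mu-1/2} C_l^lam(s) C_m^mu(t)` of real `s`, `t`. -/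
def doubleIntegrand (ε : ℕ) (lam mu nu : ℂ) (l m : ℕ) (s t : ℝ) : ℂ :=
  ((|s - t| : ℝ) : ℂ) ^ (2 * nu) * ((Real.sign (s - t) ^ ε : ℝ) : ℂ) *
    ((1 - s ^ 2 : ℝ) : ℂ) ^ (lam - 1 / 2) * ((1 - t ^ 2 : ℝ) : ℂ) ^ (mu - 1 / 2) *
    (gegenbauerC lam l).eval (s : ℂ) * (gegenbauerC mu m).eval (t : ℂ)

/-- The right-hand side `½ (1 + (-1)^{l+m+ε}) b^{lam,mu,nu}_{l,m} v_l^lam v_m^mu`. -/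
def doubleValue (ε : ℕ) (lam mu nu : ℂ) (l m : ℕ) : ℂ :=
  1 / 2 * (1 + (-1 : ℂ) ^ (l + m + ε)) * coeffB lam mu nu l m *
    gegenbauerV lam l * gegenbauerV mu m

end

open Polynomial MeasureTheory

/-! Fix `lam`, `mu` and regard both sides as functions of `nu`. If `nu = N / 2` with `N + ε` even,
the kernel is the polynomial `(s - t)^N`, and the integral is a finite sum of products of moments `∫
s^j C_l^lam(s) (1 - s²)^(lam - 1/2) ds`. Repeated integration by parts evaluates these moments, and
the sum collapses by the Chu-Vandermonde identity (`binomialMoment_add`). So the formula holds at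
these half-integers.

To reach every `nu` with positive real part, both sides are written as `∫ g^nu w` with `g ≥ 0`
bounded and `w` integrable (`IsMomentFunction`). Such a function is determined by its values at the
half-integers of one parity, by Weierstrass approximation (`IsMomentFunction.eq_of_eq_half_nat`).
The integral has this shape with `g = (s - t)²`. The Gamma quotient acquires it after duplication,
Beta integrals and division by a power of `nu + 1` (`exists_isMomentFunction_doubleRegular`).

The computation uses `doubleRegular`, in which the singular factors at `lam = 0` and `mu = 0` have
been cancelled; it agrees with the stated constant elsewhere and is continuous, which gives the
limit statement. -/

/-! ### Coefficients, derivative and differential equation of Gegenbauer polynomials. -/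

theorem coeff_gegenbauerC (lam : ℂ) (n j : ℕ) :
    (gegenbauerC lam n).coeff j = ∑ k ∈ Finset.range (n / 2 + 1),
      if j = n - 2 * k then (-1 : ℂ) ^ k * (ascPochhammer ℂ (n - k)).eval lam /
        ((k.factorial : ℂ) * ((n - 2 * k).factorial : ℂ)) * 2 ^ (n - 2 * k) else 0 := by
  rw [gegenbauerC, finsetSum_coeff]
  refine Finset.sum_congr rfl fun k _ => ?_
  rw [mul_pow, show (2 : ℂ[X]) = C 2 from rfl, ← C_pow, ← mul_assoc, ← C_mul, coeff_C_mul_X_pow]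

theorem coeff_gegenbauerC_sub (lam : ℂ) {n k : ℕ} (hk : 2 * k ≤ n) :
    (gegenbauerC lam n).coeff (n - 2 * k) = (-1 : ℂ) ^ k * (ascPochhammer ℂ (n - k)).eval lam /
        ((k.factorial : ℂ) * ((n - 2 * k).factorial : ℂ)) * 2 ^ (n - 2 * k) := by
  rw [coeff_gegenbauerC, Finset.sum_eq_single_of_mem k (by simp; omega)]
  · simp
  · intro i hi hik
    rw [if_neg]
    simp at hi
    omega

theorem coeff_gegenbauerC_eq_zero (lam : ℂ) {n j : ℕ} (h : ∀ k, 2 * k ≤ n → j ≠ n - 2 * k) :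
    (gegenbauerC lam n).coeff j = 0 := by
  rw [coeff_gegenbauerC]
  refine Finset.sum_eq_zero fun k hk => if_neg (h k ?_)
  simp at hk
  omega

theorem natDegree_gegenbauerC_le (lam : ℂ) (n : ℕ) : (gegenbauerC lam n).natDegree ≤ n := by
  rw [natDegree_le_iff_coeff_eq_zero]
  exact fun j hj => coeff_gegenbauerC_eq_zero lam fun k _ => by omega

@[simp] theorem gegenbauerC_zero (lam : ℂ) : gegenbauerC lam 0 = 1 := by simp [gegenbauerC]

theorem coeff_gegenbauerC_self (lam : ℂ) (n : ℕ) :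
    (gegenbauerC lam n).coeff n = 2 ^ n * (ascPochhammer ℂ n).eval lam / n.factorial := by
  have := coeff_gegenbauerC_sub lam (n := n) (k := 0) (by omega)
  simp at this
  rw [this]; ring

/-- This is the Gegenbauer differential equation read off coefficient by coefficient. -/
theorem coeff_gegenbauerC_add_two (lam : ℂ) (n j : ℕ) :
    ((j : ℂ) + 2) * (j + 1) * (gegenbauerC lam n).coeff (j + 2) =
      (j - n) * (j + n + 2 * lam) * (gegenbauerC lam n).coeff j := by
  by_cases h : ∃ k, 2 * k ≤ n ∧ j = n - 2 * k
  · obtain ⟨k, hk, rfl⟩ := h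
    -- For `k = 0` one has `j = n`: the factor `j - n` vanishes, and so does the coefficient above
    -- the degree.
    obtain _ | k := k
    · rw [coeff_gegenbauerC_eq_zero lam (j := n - 2 * 0 + 2) (fun k _ => by omega)]
      simp
    · obtain ⟨r, rfl⟩ := Nat.exists_eq_add_of_le hk
      have h1 := coeff_gegenbauerC_sub lam (n := 2 * (k + 1) + r) (k := k) (by omega)
      rw [coeff_gegenbauerC_sub lam hk]
      rw [show 2 * (k + 1) + r - 2 * (k + 1) = r by omega]
      rw [show 2 * (k + 1) + r - 2 * k = r + 2 by omega] at h1
      rw [h1, show 2 * (k + 1) + r - k = k + 1 + r + 1 by omega,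
        show 2 * (k + 1) + r - (k + 1) = k + 1 + r by omega, ascPochhammer_succ_eval,
        Nat.factorial_succ (r + 1), Nat.factorial_succ r, Nat.factorial_succ k]
      have := Nat.factorial_ne_zero k
      have := Nat.factorial_ne_zero r
      have : (k : ℂ) + 1 ≠ 0 := by exact_mod_cast Nat.succ_ne_zero k
      have : (r : ℂ) + 1 ≠ 0 := by exact_mod_cast Nat.succ_ne_zero r
      have : (r : ℂ) + 1 + 1 ≠ 0 := by exact_mod_cast Nat.succ_ne_zero (r + 1)
      push_cast
      field_simp
      ring
  · push Not at h
    rw [coeff_gegenbauerC_eq_zero lam h]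
    rw [coeff_gegenbauerC_eq_zero lam (j := j + 2), mul_zero, mul_zero]
    intro k hk hjk
    exact h (k + 1) (by omega) (by omega)

/-- Comes from `(lam)_{j+1} = lam (lam+1)_j`. Differentiation trades a degree for a unit of the
parameter, which drives the induction on the degree below. -/
theorem derivative_gegenbauerC_succ (lam : ℂ) (n : ℕ) :
    derivative (gegenbauerC lam (n + 1)) = C (2 * lam) * gegenbauerC (lam + 1) n := by
  ext j
  rw [coeff_derivative, coeff_C_mul]
  by_cases h : ∃ k, 2 * k ≤ n ∧ j = n - 2 * k
  · obtain ⟨k, hk, rfl⟩ := h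
    obtain ⟨r, rfl⟩ := Nat.exists_eq_add_of_le hk
    have h1 := coeff_gegenbauerC_sub lam (n := 2 * k + r + 1) (k := k) (by omega)
    rw [coeff_gegenbauerC_sub _ hk]
    rw [show 2 * k + r - 2 * k = r by omega]
    rw [show 2 * k + r + 1 - 2 * k = r + 1 by omega] at h1
    rw [h1, show 2 * k + r + 1 - k = (k + r) + 1 by omega, show 2 * k + r - k = k + r by omega,
      ascPochhammer_succ_left, Nat.factorial_succ]
    have := Nat.factorial_ne_zero k
    have := Nat.factorial_ne_zero r
    have : (r : ℂ) + 1 ≠ 0 := by exact_mod_cast Nat.succ_ne_zero r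
    simp only [eval_mul, eval_X, eval_comp, eval_add, eval_one]
    push_cast
    field_simp
    ring
  · push Not at h
    rw [coeff_gegenbauerC_eq_zero _ h, coeff_gegenbauerC_eq_zero lam (j := j + 1)]
    · simp
    · intro k hk hjk
      exact h k (by omega) (by omega)

/-- The Gegenbauer differential equation. -/
theorem gegenbauerC_ode (lam : ℂ) (n : ℕ) :
    (1 - X ^ 2) * derivative (derivative (gegenbauerC lam n)) -
      C (2 * lam + 1) * X * derivative (gegenbauerC lam n) =
      -(C (n * (n + 2 * lam)) * gegenbauerC lam n) := by
  ext j
  have h := coeff_gegenbauerC_add_two lam n j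
  rw [sub_mul, one_mul, mul_assoc, coeff_sub, coeff_sub, coeff_C_mul, coeff_neg, coeff_C_mul]
  obtain _ | _ | j := j
  · simp [coeff_derivative] at h ⊢
    linear_combination h
  · simp [coeff_derivative, coeff_X_pow_mul', coeff_X_mul] at h ⊢
    linear_combination h
  · rw [coeff_X_pow_mul, coeff_X_mul]
    simp only [coeff_derivative]
    push_cast at h ⊢
    linear_combination h

/-! ### The Gegenbauer weight and integration by parts. -/

/-- The weight `(1 - s²)^{lam - 1/2}`. -/
noncomputable def gegenbauerWeight (lam : ℂ) (s : ℝ) : ℂ := ((1 - s ^ 2 : ℝ) : ℂ) ^ (lam - 1 / 2)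

/-- Integration of polynomials against the Gegenbauer weight. -/
noncomputable def gegenbauerIntegral (lam : ℂ) (p : ℂ[X]) : ℂ :=
  ∫ s in (-1 : ℝ)..1, p.eval (s : ℂ) * gegenbauerWeight lam s

/-- With `x = (s + 1) / 2` one has `1 - s² = 4 x (1 - x)`, which turns the weight into a Beta
density. -/
theorem gegenbauerWeight_eq_beta (lam : ℂ) {s : ℝ} (hs : s ∈ Set.Icc (-1 : ℝ) 1) :
    gegenbauerWeight lam s = (4 : ℂ) ^ (lam - 1 / 2) *
      ((((1 / 2) * s + 1 / 2 : ℝ) : ℂ) ^ (lam + 1 / 2 - 1) *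
        (1 - (((1 / 2) * s + 1 / 2 : ℝ) : ℂ)) ^ (lam + 1 / 2 - 1)) := by
  have h1 : 0 ≤ 1 / 2 * s + 1 / 2 := by linarith [hs.1]
  have h2 : 0 ≤ 1 - (1 / 2 * s + 1 / 2) := by linarith [hs.2]
  rw [show lam + 1 / 2 - 1 = lam - 1 / 2 by ring, gegenbauerWeight]
  have h3 : ((1 - (1 / 2 * s + 1 / 2) : ℝ) : ℂ) = 1 - ((1 / 2 * s + 1 / 2 : ℝ) : ℂ) := by push_cast; rfl
  rw [← h3, ← Complex.mul_cpow_ofReal_nonneg h1 h2, ← Complex.ofReal_mul,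
    show (4 : ℂ) = ((4 : ℝ) : ℂ) by norm_num,
    ← Complex.mul_cpow_ofReal_nonneg (by norm_num) (by positivity), ← Complex.ofReal_mul]
  congr 2
  ring

theorem intervalIntegrable_gegenbauerWeight {lam : ℂ} (hlam : -1 / 2 < lam.re) :
    IntervalIntegrable (gegenbauerWeight lam) volume (-1) 1 := by
  have hre : 0 < (lam + 1 / 2).re := by
    have : (lam + 1 / 2).re = lam.re + 1 / 2 := by simp
    linarith
  have h := ((Complex.betaIntegral_convergent hre hre).comp_add_right (1 / 2)).comp_mul_left
    (c := 1 / 2)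
  norm_num at h
  refine (h.const_mul ((4 : ℂ) ^ (lam - 1 / 2))).congr ?_
  intro s hs
  rw [Set.uIoc_of_le (by norm_num)] at hs
  simp only
  rw [gegenbauerWeight_eq_beta lam (Set.Ioc_subset_Icc_self hs)]
  norm_num

theorem intervalIntegrable_mul_gegenbauerWeight {lam : ℂ} (hlam : -1 / 2 < lam.re) (p : ℂ[X]) :
    IntervalIntegrable (fun s : ℝ => p.eval (s : ℂ) * gegenbauerWeight lam s) volume (-1) 1 :=
  (intervalIntegrable_gegenbauerWeight hlam).continuousOn_mul (by fun_prop)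

theorem gegenbauerIntegral_add {lam : ℂ} (hlam : -1 / 2 < lam.re) (p q : ℂ[X]) :
    gegenbauerIntegral lam (p + q) = gegenbauerIntegral lam p + gegenbauerIntegral lam q := by
  simp only [gegenbauerIntegral, eval_add, add_mul]
  exact intervalIntegral.integral_add (intervalIntegrable_mul_gegenbauerWeight hlam p)
    (intervalIntegrable_mul_gegenbauerWeight hlam q)

theorem gegenbauerIntegral_C_mul (lam : ℂ) (a : ℂ) (p : ℂ[X]) :
    gegenbauerIntegral lam (C a * p) = a * gegenbauerIntegral lam p := by
  simp only [gegenbauerIntegral, eval_mul, eval_C, mul_assoc]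
  exact intervalIntegral.integral_const_mul _ _

theorem gegenbauerIntegral_neg (lam : ℂ) (p : ℂ[X]) :
    gegenbauerIntegral lam (-p) = -gegenbauerIntegral lam p := by
  simpa using gegenbauerIntegral_C_mul lam (-1) p

theorem gegenbauerIntegral_sub {lam : ℂ} (hlam : -1 / 2 < lam.re) (p q : ℂ[X]) :
    gegenbauerIntegral lam (p - q) = gegenbauerIntegral lam p - gegenbauerIntegral lam q := by
  rw [sub_eq_add_neg, gegenbauerIntegral_add hlam, gegenbauerIntegral_neg, sub_eq_add_neg]

theorem gegenbauerIntegral_sum {lam : ℂ} (hlam : -1 / 2 < lam.re) {ι : Type*} (t : Finset ι)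
    (p : ι → ℂ[X]) :
    gegenbauerIntegral lam (∑ i ∈ t, p i) = ∑ i ∈ t, gegenbauerIntegral lam (p i) := by
  classical
  induction t using Finset.induction_on with
  | empty => simp [gegenbauerIntegral]
  | insert i t hi ih => rw [Finset.sum_insert hi, Finset.sum_insert hi,
      gegenbauerIntegral_add hlam, ih]

theorem gegenbauerWeight_add_one {lam : ℂ} {s : ℝ} (hs : s ^ 2 < 1) :
    gegenbauerWeight (lam + 1) s = (1 - (s : ℂ) ^ 2) * gegenbauerWeight lam s := by
  have h : ((1 - s ^ 2 : ℝ) : ℂ) ≠ 0 := by exact_mod_cast (by linarith : (1 - s ^ 2) ≠ 0)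
  rw [gegenbauerWeight, gegenbauerWeight, show lam + 1 - 1 / 2 = lam - 1 / 2 + 1 by ring,
    Complex.cpow_add _ _ h, Complex.cpow_one]
  push_cast
  ring

theorem gegenbauerIntegral_add_one (lam : ℂ) (p : ℂ[X]) :
    gegenbauerIntegral (lam + 1) p = gegenbauerIntegral lam ((1 - X ^ 2) * p) := by
  refine intervalIntegral.integral_congr_ae ?_
  have h1 : ∀ᵐ s : ℝ, s ≠ 1 := by simp [ae_iff]
  filter_upwards [h1] with s hs1 hs
  rw [Set.uIoc_of_le (by norm_num)] at hs
  have : s < 1 := lt_of_le_of_ne hs.2 hs1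
  rw [gegenbauerWeight_add_one (by nlinarith [hs.1])]
  simp only [eval_mul, eval_sub, eval_one, eval_pow, eval_X]
  ring

/-- Integration by parts against the Gegenbauer weight. -/
theorem gegenbauerIntegral_derivative {lam : ℂ} (hlam : -1 / 2 < lam.re) (p : ℂ[X]) :
    gegenbauerIntegral lam ((1 - X ^ 2) * derivative p - C (2 * lam + 1) * X * p) = 0 := by
  have hre : 0 < (lam + 1 - 1 / 2).re := by
    have : (lam + 1 - 1 / 2).re = lam.re + 1 / 2 := by simp; ring
    linarith
  have hne : lam + 1 - 1 / 2 ≠ 0 := fun h => by rw [h] at hre; simp at hre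
  have h0 : ∀ s : ℝ, s ^ 2 = 1 → gegenbauerWeight (lam + 1) s = 0 := fun s hs => by
    rw [gegenbauerWeight, hs, sub_self, Complex.ofReal_zero, Complex.zero_cpow hne]
  -- The integrand is the derivative of `p(s) (1 - s²)^(lam + 1/2)`, which vanishes at both
  -- endpoints.
  rw [gegenbauerIntegral, intervalIntegral.integral_eq_sub_of_hasDerivAt_of_le
    (f := fun s : ℝ => p.eval (s : ℂ) * gegenbauerWeight (lam + 1) s) (by norm_num) ?_ ?_
    (intervalIntegrable_mul_gegenbauerWeight hlam _)]
  · simp [h0]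
  · have : Continuous (gegenbauerWeight (lam + 1)) :=
      (Complex.continuous_ofReal_cpow_const hre).comp (by fun_prop : Continuous fun s : ℝ => 1 - s ^ 2)
    fun_prop
  · intro s hs
    have hs2 : s ^ 2 < 1 := by nlinarith [hs.1, hs.2]
    have hw : HasDerivAt (gegenbauerWeight (lam + 1)) (-(2 * lam + 1) * s * gegenbauerWeight lam s) s := by
      have h1 : HasDerivAt (fun s : ℝ => 1 - s ^ 2) (-(2 * s)) s := by
        simpa using (hasDerivAt_pow 2 s).const_sub 1
      have h2 := ((hasDerivAt_ofReal_cpow_const (x := 1 - s ^ 2) (by linarith) hne).scomp s h1)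
      refine h2.congr_deriv ?_
      rw [gegenbauerWeight, show lam + 1 - 1 / 2 - 1 = lam - 1 / 2 by ring, Complex.real_smul]
      push_cast
      ring
    have hp : HasDerivAt (fun s : ℝ => p.eval (s : ℂ)) ((derivative p).eval (s : ℂ)) s :=
      (p.hasDerivAt (s : ℂ)).comp_ofReal
    refine (hp.mul hw).congr_deriv ?_
    rw [gegenbauerWeight_add_one hs2]
    simp only [eval_mul, eval_sub, eval_one, eval_pow, eval_X, eval_C]
    ring

/-! ### Moments of the weight. -/

theorem Gamma_mul_cpow_duplication (lam : ℂ) :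
    Complex.Gamma (2 * lam + 1) * Real.sqrt Real.pi =
      4 ^ lam * Complex.Gamma (lam + 1 / 2) * Complex.Gamma (lam + 1) := by
  have h := Complex.Gamma_mul_Gamma_add_half (lam + 1 / 2)
  rw [show lam + 1 / 2 + 1 / 2 = lam + 1 by ring, show 2 * (lam + 1 / 2) = 2 * lam + 1 by ring,
    show 1 - (2 * lam + 1) = -(2 * lam) by ring, Complex.cpow_neg, Complex.cpow_ofNat_mul] at h
  have h4 : (2 ^ lam : ℂ) ^ 2 = 4 ^ lam := by
    rw [show (4 : ℂ) = ((2 : ℝ) : ℂ) * ((2 : ℝ) : ℂ) by norm_num,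
      Complex.mul_cpow_ofReal_nonneg (by norm_num) (by norm_num)]
    push_cast
    ring
  have hne : (4 : ℂ) ^ lam ≠ 0 := by simp [Complex.cpow_eq_zero_iff]
  rw [mul_assoc, h, h4]
  field_simp

theorem gegenbauerIntegral_one {lam : ℂ} (hlam : -1 / 2 < lam.re) :
    gegenbauerIntegral lam 1 =
      Real.sqrt Real.pi * Complex.Gamma (lam + 1 / 2) / Complex.Gamma (lam + 1) := by
  have hre : 0 < (lam + 1 / 2).re := by
    have : (lam + 1 / 2).re = lam.re + 1 / 2 := by simp
    linarith
  have hre1 : 0 < (lam + 1).re := by simp; linarith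
  have hre2 : 0 < (2 * lam + 1).re := by simp; linarith
  have h1 : gegenbauerIntegral lam 1 = 2 * 4 ^ (lam - 1 / 2) *
      Complex.betaIntegral (lam + 1 / 2) (lam + 1 / 2) := by
    have h := intervalIntegral.integral_comp_mul_add (a := -1) (b := 1) (c := 1 / 2)
      (fun x : ℝ => (x : ℂ) ^ (lam + 1 / 2 - 1) * (1 - (x : ℂ)) ^ (lam + 1 / 2 - 1))
      (by norm_num) (1 / 2)
    rw [show (1 / 2 : ℝ) * -1 + 1 / 2 = 0 by norm_num, show (1 / 2 : ℝ) * 1 + 1 / 2 = 1 by norm_num] at h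
    rw [gegenbauerIntegral, Complex.betaIntegral]
    rw [show (2 : ℂ) * 4 ^ (lam - 1 / 2) * (∫ x in (0 : ℝ)..1, (x : ℂ) ^ (lam + 1 / 2 - 1) *
      (1 - (x : ℂ)) ^ (lam + 1 / 2 - 1)) = 4 ^ (lam - 1 / 2) * (2 * ∫ x in (0 : ℝ)..1,
      (x : ℂ) ^ (lam + 1 / 2 - 1) * (1 - (x : ℂ)) ^ (lam + 1 / 2 - 1)) by ring]
    have h2 : (2 : ℂ) * (∫ x in (0 : ℝ)..1, (x : ℂ) ^ (lam + 1 / 2 - 1) *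
      (1 - (x : ℂ)) ^ (lam + 1 / 2 - 1)) = (1 / 2 : ℝ)⁻¹ • ∫ x in (0 : ℝ)..1,
      (x : ℂ) ^ (lam + 1 / 2 - 1) * (1 - (x : ℂ)) ^ (lam + 1 / 2 - 1) := by
      rw [Complex.real_smul]; norm_num
    rw [h2, ← h, ← intervalIntegral.integral_const_mul]
    refine intervalIntegral.integral_congr fun s hs => ?_
    rw [Set.uIcc_of_le (by norm_num)] at hs
    simp only [eval_one, one_mul]
    exact gegenbauerWeight_eq_beta lam hs
  have h2 := Gamma_mul_cpow_duplication lam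
  have hG1 := Complex.Gamma_ne_zero_of_re_pos hre1
  have hG2 := Complex.Gamma_ne_zero_of_re_pos hre2
  have h4 : (4 : ℂ) ^ (lam - 1 / 2) * 2 = 4 ^ lam := by
    rw [Complex.cpow_sub _ _ (by norm_num)]
    have : (4 : ℂ) ^ (1 / 2 : ℂ) = 2 := by
      rw [show (4 : ℂ) = 2 ^ (2 : ℕ) by norm_num, show (1 / 2 : ℂ) = (((2 : ℕ) : ℂ))⁻¹ by norm_num]
      refine Complex.pow_cpow_nat_inv (by norm_num) ?_ ?_ <;> simp [Real.pi_pos]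
      positivity
    rw [this]; field_simp
  rw [h1, Complex.betaIntegral_eq_Gamma_mul_div _ _ hre hre,
    show lam + 1 / 2 + (lam + 1 / 2) = 2 * lam + 1 by ring, mul_comm (2 : ℂ), h4,
    mul_div_assoc', div_eq_div_iff hG2 hG1]
  linear_combination -Complex.Gamma (lam + 1 / 2) * h2

/-- Integration by parts with `p = X^(r+1)`. -/
theorem gegenbauerIntegral_X_pow_add_two {lam : ℂ} (hlam : -1 / 2 < lam.re) (r : ℕ) :
    (r + 2 * lam + 2) * gegenbauerIntegral lam (X ^ (r + 2)) =
      (r + 1) * gegenbauerIntegral lam (X ^ r) := by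
  have h := gegenbauerIntegral_derivative hlam (X ^ (r + 1))
  have h1 : (1 - X ^ 2) * derivative (X ^ (r + 1)) - C (2 * lam + 1) * X * X ^ (r + 1) =
      C ((r : ℂ) + 1) * X ^ r - C (r + 2 * lam + 2) * X ^ (r + 2) := by
    rw [derivative_X_pow]
    simp only [map_add, map_mul, map_natCast, map_one, map_ofNat, add_tsub_cancel_right]
    push_cast
    ring
  rw [h1, gegenbauerIntegral_sub hlam, gegenbauerIntegral_C_mul, gegenbauerIntegral_C_mul] at h
  linear_combination -h

theorem gegenbauerIntegral_X_pow_odd {lam : ℂ} (hlam : -1 / 2 < lam.re) (i : ℕ) :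
    gegenbauerIntegral lam (X ^ (2 * i + 1)) = 0 := by
  induction i with
  | zero =>
    have h := gegenbauerIntegral_derivative hlam 1
    have hne : 2 * lam + 1 ≠ 0 := fun h => by
      have := congrArg Complex.re h
      simp at this; linarith
    simp only [derivative_one, mul_zero, zero_sub, mul_one] at h
    rw [gegenbauerIntegral_neg, gegenbauerIntegral_C_mul] at h
    simpa [hne] using h
  | succ i ih =>
    have h := gegenbauerIntegral_X_pow_add_two hlam (2 * i + 1)
    rw [ih, mul_zero] at h
    refine (mul_eq_zero.1 h).resolve_left fun h => ?_
    have := congrArg Complex.re h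
    simp at this
    have : (0 : ℝ) ≤ i := i.cast_nonneg
    linarith

theorem gegenbauerIntegral_X_pow_even {lam : ℂ} (hlam : -1 / 2 < lam.re) (i : ℕ) :
    gegenbauerIntegral lam (X ^ (2 * i)) = ((2 * i).factorial : ℂ) / (4 ^ i * i.factorial) *
      (Real.sqrt Real.pi * Complex.Gamma (lam + 1 / 2) / Complex.Gamma (lam + i + 1)) := by
  induction i with
  | zero => simpa using gegenbauerIntegral_one hlam
  | succ i ih =>
    have h := gegenbauerIntegral_X_pow_add_two hlam (2 * i)
    have hre : 0 < (lam + i + 1).re := by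
      have : (0 : ℝ) ≤ i := i.cast_nonneg
      simp; linarith
    have hne : lam + i + 1 ≠ 0 := fun h => by rw [h] at hre; simp at hre
    have hne' : ((2 * i : ℕ) : ℂ) + 2 * lam + 2 ≠ 0 := by
      have : ((2 * i : ℕ) : ℂ) + 2 * lam + 2 = 2 * (lam + i + 1) := by push_cast; ring
      rw [this]; simp [hne]
    have hG := Complex.Gamma_ne_zero_of_re_pos hre
    rw [show 2 * (i + 1) = 2 * i + 2 by ring]
    rw [ih] at h
    apply mul_left_cancel₀ hne'
    rw [h]
    have : lam + ((i + 1 : ℕ) : ℂ) + 1 = lam + i + 1 + 1 := by push_cast; ring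
    rw [this, Complex.Gamma_add_one _ hne, Nat.factorial_succ (2 * i + 1), Nat.factorial_succ (2 * i),
      Nat.factorial_succ i, pow_succ]
    have := Nat.factorial_ne_zero i
    have : (i : ℂ) + 1 ≠ 0 := by exact_mod_cast Nat.succ_ne_zero i
    push_cast
    field_simp
    ring

/-! ### Moments of a Gegenbauer polynomial and orthogonality. -/

/-- The differential equation makes `C_{l+1} w` a multiple of the derivative of `(1 - s²) C_{l+1}'
w`; integrating by parts moves that derivative onto `X^j`. -/
theorem gegenbauerIntegral_X_pow_mul_gegenbauerC_succ {lam : ℂ} (hlam : -1 / 2 < lam.re)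
    (l j : ℕ) :
    (l + 1) * (l + 1 + 2 * lam) * gegenbauerIntegral lam (X ^ j * gegenbauerC lam (l + 1)) =
      2 * lam * j * gegenbauerIntegral (lam + 1) (X ^ (j - 1) * gegenbauerC (lam + 1) l) := by
  have h := gegenbauerIntegral_derivative hlam (X ^ j * derivative (gegenbauerC lam (l + 1)))
  have h1 : (1 - X ^ 2) * derivative (X ^ j * derivative (gegenbauerC lam (l + 1))) -
      C (2 * lam + 1) * X * (X ^ j * derivative (gegenbauerC lam (l + 1))) =
      C (2 * lam * j) * ((1 - X ^ 2) * (X ^ (j - 1) * gegenbauerC (lam + 1) l)) -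
        C ((l + 1) * (l + 1 + 2 * lam)) * (X ^ j * gegenbauerC lam (l + 1)) := by
    have h2 := gegenbauerC_ode lam (l + 1)
    have h3 := derivative_gegenbauerC_succ lam l
    rw [derivative_mul, derivative_X_pow]
    simp only [map_mul, map_add, map_natCast, map_one, map_ofNat, Nat.cast_add, Nat.cast_one] at h2 h3 ⊢
    linear_combination X ^ j * h2 + (1 - X ^ 2) * j * X ^ (j - 1) * h3
  rw [h1, gegenbauerIntegral_sub hlam, gegenbauerIntegral_C_mul, gegenbauerIntegral_C_mul,
    ← gegenbauerIntegral_add_one] at h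
  linear_combination -h

/-- The previous identity iterated `l` times, which plays the role of Rodrigues' formula. The left
factors stay undivided, since some can vanish at `lam = 0`-type degeneracies only after the
Pochhammer symbols are recombined. -/
theorem gegenbauerIntegral_X_pow_mul_gegenbauerC_aux {lam : ℂ} (hlam : -1 / 2 < lam.re)
    (l j : ℕ) :
    (ascPochhammer ℂ l).eval (2 * lam + l) * l.factorial *
        gegenbauerIntegral lam (X ^ j * gegenbauerC lam l) =
      2 ^ l * (ascPochhammer ℂ l).eval lam * j.descFactorial l *
        gegenbauerIntegral (lam + l) (X ^ (j - l)) := by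
  induction l generalizing lam j with
  | zero => simp
  | succ l ih =>
    have h := gegenbauerIntegral_X_pow_mul_gegenbauerC_succ hlam l j
    have ih' := ih (lam := lam + 1) (by simp; linarith) (j - 1)
    have hd : ((j.descFactorial (l + 1) : ℕ) : ℂ) = j * (j - 1).descFactorial l := by
      obtain _ | j := j
      · simp
      · rw [Nat.succ_descFactorial_succ]; push_cast; rfl
    rw [ascPochhammer_succ_left, hd, Nat.factorial_succ,
      show j - (l + 1) = j - 1 - l by omega,
      show lam + ((l + 1 : ℕ) : ℂ) = lam + 1 + l by push_cast; ring]
    simp only [eval_mul, eval_X, eval_comp, eval_add, eval_one]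
    push_cast
    rw [show 2 * lam + (l + 1 : ℂ) + 1 = 2 * (lam + 1) + l by ring]
    linear_combination (ascPochhammer ℂ l).eval (2 * (lam + 1) + l) * l.factorial * h +
      2 * lam * j * ih'

theorem Gamma_add_natCast {z : ℂ} (hz : ∀ k : ℕ, z ≠ -k) (n : ℕ) :
    Complex.Gamma (z + n) = (ascPochhammer ℂ n).eval z * Complex.Gamma z := by
  induction n with
  | zero => simp
  | succ n ih =>
    rw [Nat.cast_succ, ← add_assoc, Complex.Gamma_add_one, ih, ascPochhammer_succ_eval]
    · ring
    · exact fun h => hz n (by linear_combination h)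

theorem ne_neg_natCast_of_re_pos {z : ℂ} (hz : 0 < z.re) (k : ℕ) : z ≠ -k := fun h => by
  have h1 := congrArg Complex.re h
  have : (0 : ℝ) ≤ k := k.cast_nonneg
  simp at h1
  linarith

theorem ascPochhammer_two_mul_eval (lam : ℂ) (n : ℕ) :
    (ascPochhammer ℂ n).eval (2 * lam) * (ascPochhammer ℂ n).eval (2 * lam + n) =
      4 ^ n * (ascPochhammer ℂ n).eval lam * (ascPochhammer ℂ n).eval (lam + 1 / 2) := by
  have h : (ascPochhammer ℂ (n + n)).eval (2 * lam) =
      4 ^ n * (ascPochhammer ℂ n).eval lam * (ascPochhammer ℂ n).eval (lam + 1 / 2) := by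
    induction n with
    | zero => simp
    | succ n ih =>
      rw [show n + 1 + (n + 1) = n + n + 1 + 1 by ring]
      simp only [ascPochhammer_succ_eval, ih]
      push_cast
      ring
  rw [← h, ← ascPochhammer_mul]
  simp [eval_comp]

/-- The regular part `(lam + l) Γ(lam) v_l^lam` of the constant `v_l^lam`. -/
noncomputable def gegenbauerA (lam : ℂ) (l : ℕ) : ℂ :=
  Real.sqrt Real.pi * (ascPochhammer ℂ l).eval (2 * lam) * Complex.Gamma (lam + 1 / 2) / l.factorial

theorem gegenbauerIntegral_X_pow_mul_gegenbauerC_eq {lam : ℂ} (hlam : -1 / 2 < lam.re) (l j : ℕ) :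
    2 ^ l * Complex.Gamma (lam + l + 1 / 2) * gegenbauerIntegral lam (X ^ j * gegenbauerC lam l) *
      Real.sqrt Real.pi = gegenbauerA lam l * j.descFactorial l *
        gegenbauerIntegral (lam + l) (X ^ (j - l)) := by
  have h := gegenbauerIntegral_X_pow_mul_gegenbauerC_aux hlam l j
  -- For `l ≥ 1` the base point has positive real part; for `l = 0` the symbol is `1`.
  have hne : (ascPochhammer ℂ l).eval (2 * lam + l) ≠ 0 := by
    obtain _ | l := l
    · simp
    · have hre : 0 < (2 * lam + (l + 1 : ℕ)).re := by
        have : (0 : ℝ) ≤ l := l.cast_nonneg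
        simp; linarith
      intro h0
      have h1 := Gamma_add_natCast (ne_neg_natCast_of_re_pos hre) (l + 1)
      rw [h0, zero_mul] at h1
      refine Complex.Gamma_ne_zero_of_re_pos ?_ h1
      have : (0 : ℝ) ≤ l := l.cast_nonneg
      simp at hre ⊢; linarith
  have hG := Gamma_add_natCast (z := lam + 1 / 2)
    (ne_neg_natCast_of_re_pos (by simp; linarith)) l
  have hd := ascPochhammer_two_mul_eval lam l
  have hf : (l.factorial : ℂ) ≠ 0 := by exact_mod_cast l.factorial_ne_zero
  rw [show lam + l + 1 / 2 = lam + 1 / 2 + l by ring, hG, gegenbauerA]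
  have h4 : (4 : ℂ) ^ l = 2 ^ l * 2 ^ l := by rw [← mul_pow]; norm_num
  rw [h4] at hd
  generalize (ascPochhammer ℂ l).eval (lam + 1 / 2) = x at *
  generalize Complex.Gamma (lam + 1 / 2) = G
  field_simp
  apply mul_left_cancel₀ hne
  linear_combination (2 ^ l * x * G) * h - G * j.descFactorial l *
    gegenbauerIntegral (lam + l) (X ^ (j - l)) * hd

theorem gegenbauerIntegral_X_pow_mul_gegenbauerC {lam : ℂ} (hlam : -1 / 2 < lam.re) (l i : ℕ) :
    gegenbauerIntegral lam (X ^ (l + 2 * i) * gegenbauerC lam l) =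
      (l + 2 * i).factorial / (2 ^ l * 4 ^ i * i.factorial) * gegenbauerA lam l *
        (Complex.Gamma (lam + l + i + 1))⁻¹ := by
  have hl : (0 : ℝ) ≤ l := l.cast_nonneg
  have h := gegenbauerIntegral_X_pow_mul_gegenbauerC_eq hlam l (l + 2 * i)
  rw [add_tsub_cancel_left, gegenbauerIntegral_X_pow_even (by simp; linarith)] at h
  have hG : Complex.Gamma (lam + l + 1 / 2) ≠ 0 :=
    Complex.Gamma_ne_zero_of_re_pos (by simp; linarith)
  have hpi : (Real.sqrt Real.pi : ℂ) ≠ 0 := by exact_mod_cast (Real.sqrt_pos.2 Real.pi_pos).ne'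
  have hf : ((l + 2 * i).descFactorial l : ℂ) * (2 * i).factorial = (l + 2 * i).factorial := by
    have := Nat.factorial_mul_descFactorial (n := l + 2 * i) (k := l) (by omega)
    rw [add_tsub_cancel_left, mul_comm] at this
    exact_mod_cast this
  apply mul_left_cancel₀ (mul_ne_zero hG hpi)
  rw [← hf]
  apply mul_left_cancel₀ (pow_ne_zero l (two_ne_zero (α := ℂ)))
  have hi : (i.factorial : ℂ) ≠ 0 := by exact_mod_cast i.factorial_ne_zero
  rw [show ∀ x : ℂ, 2 ^ l * (Complex.Gamma (lam + l + 1 / 2) * Real.sqrt Real.pi * x) =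
    2 ^ l * Complex.Gamma (lam + l + 1 / 2) * x * Real.sqrt Real.pi from fun x => by ring, h]
  field_simp

/-- The falling factorial kills `j < l`, and symmetry of the weight kills odd `j - l`. -/
theorem gegenbauerIntegral_X_pow_mul_gegenbauerC_eq_zero {lam : ℂ} (hlam : -1 / 2 < lam.re)
    {l j : ℕ} (h : ∀ i, j ≠ l + 2 * i) :
    gegenbauerIntegral lam (X ^ j * gegenbauerC lam l) = 0 := by
  have hl : (0 : ℝ) ≤ l := l.cast_nonneg
  have h1 := gegenbauerIntegral_X_pow_mul_gegenbauerC_eq hlam l j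
  have h2 : (j.descFactorial l : ℂ) * gegenbauerIntegral (lam + l) (X ^ (j - l)) = 0 := by
    by_cases hj : j < l
    · rw [Nat.descFactorial_of_lt hj]; simp
    · obtain ⟨i, hi | hi⟩ := Nat.even_or_odd' (j - l)
      · exact absurd (by omega) (h i)
      · rw [hi, gegenbauerIntegral_X_pow_odd (by simp; linarith), mul_zero]
  have hG : Complex.Gamma (lam + l + 1 / 2) ≠ 0 :=
    Complex.Gamma_ne_zero_of_re_pos (by simp; linarith)
  have hpi : (Real.sqrt Real.pi : ℂ) ≠ 0 := by exact_mod_cast (Real.sqrt_pos.2 Real.pi_pos).ne'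
  rw [mul_assoc (gegenbauerA _ _), h2, mul_zero] at h1
  exact (mul_eq_zero.1 ((mul_eq_zero.1 h1).resolve_right hpi)).resolve_left
    (mul_ne_zero (pow_ne_zero _ two_ne_zero) hG)

/-! ### The formula at half-integers, by Chu-Vandermonde. -/

/-- The Chu-Vandermonde identity in terms of Gamma functions. -/
theorem sum_antidiagonal_Gamma {a b : ℂ} (ha : -1 < a.re) (hb : -1 < b.re)
    (hab : -1 < (a + b).re) (K : ℕ) :
    ∑ p ∈ Finset.HasAntidiagonal.antidiagonal K, ((p.1.factorial : ℂ) * p.2.factorial)⁻¹ *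
        ((Complex.Gamma (a + p.1 + 1))⁻¹ * (Complex.Gamma (b + p.2 + 1))⁻¹) =
      Complex.Gamma (a + b + 2 * K + 1) * ((K.factorial : ℂ) * Complex.Gamma (a + K + 1) *
        Complex.Gamma (b + K + 1) * Complex.Gamma (a + b + K + 1))⁻¹ := by
  have key : ∀ (z : ℂ) (k : ℕ), 0 < (z + 1).re → Ring.choose (z + k) k =
      Complex.Gamma (z + k + 1) * ((k.factorial : ℂ) * Complex.Gamma (z + 1))⁻¹ := by
    intro z k hz
    have h := Ring.factorial_nsmul_multichoose_eq_ascPochhammer (z + 1) k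
    rw [ascPochhammer_smeval_eq_eval] at h
    have hG := Gamma_add_natCast (ne_neg_natCast_of_re_pos hz) k
    rw [Ring.choose, show z + k - k + 1 = z + 1 by ring, show z + k + 1 = z + 1 + k by ring, hG]
    have hf : (k.factorial : ℂ) ≠ 0 := by exact_mod_cast k.factorial_ne_zero
    have := Complex.Gamma_ne_zero_of_re_pos hz
    rw [nsmul_eq_mul] at h
    field_simp
    rw [← h]
    ring
  have pos : ∀ (z : ℂ) (k : ℕ), -1 < z.re → 0 < (z + k + 1).re := fun z k hz => by
    have : (0 : ℝ) ≤ k := k.cast_nonneg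
    simp; linarith
  -- Since `p.1 + p.2 = K`, `choose (b + K) p.1` carries `1 / Γ(b + p.2 + 1)`, and symmetrically for
  -- `a`. These are the reciprocals in the sum.
  have hV := Ring.add_choose_eq K (Commute.all (b + K) (a + K))
  have h1 := key (a + b + K) K (pos _ _ hab)
  rw [show b + K + (a + K) = a + b + K + K by ring, h1] at hV
  have hGa := Complex.Gamma_ne_zero_of_re_pos (pos a K ha)
  have hGb := Complex.Gamma_ne_zero_of_re_pos (pos b K hb)
  rw [show a + b + 2 * (K : ℂ) + 1 = a + b + K + K + 1 by ring]
  have h2 : Complex.Gamma (a + b + K + K + 1) * ((K.factorial : ℂ) * Complex.Gamma (a + K + 1) *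
        Complex.Gamma (b + K + 1) * Complex.Gamma (a + b + K + 1))⁻¹ =
      (Complex.Gamma (a + K + 1) * Complex.Gamma (b + K + 1))⁻¹ *
      (Complex.Gamma (a + b + K + K + 1) *
        ((K.factorial : ℂ) * Complex.Gamma (a + b + K + 1))⁻¹) := by
    simp only [mul_inv]; ring
  rw [h2, hV, Finset.mul_sum]
  refine Finset.sum_congr rfl fun p hp => ?_
  have hK : (K : ℂ) = p.1 + p.2 := by
    rw [Finset.HasAntidiagonal.mem_antidiagonal] at hp
    exact_mod_cast hp.symm
  have e1 : Ring.choose (b + K) p.1 = Complex.Gamma (b + K + 1) *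
      ((p.1.factorial : ℂ) * Complex.Gamma (b + p.2 + 1))⁻¹ := by
    have := key (b + p.2) p.1 (pos _ _ hb)
    rwa [show b + (p.2 : ℂ) + p.1 = b + K by rw [hK]; ring] at this
  have e2 : Ring.choose (a + K) p.2 = Complex.Gamma (a + K + 1) *
      ((p.2.factorial : ℂ) * Complex.Gamma (a + p.1 + 1))⁻¹ := by
    have := key (a + p.1) p.2 (pos _ _ ha)
    rwa [show a + (p.1 : ℂ) + p.2 = a + K by rw [hK]; ring] at this
  rw [e1, e2]
  simp only [mul_inv]
  field_simp

/-- The right-hand side of the double integral formula without its parity factor, in a form that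
is regular at `lam = 0` and `mu = 0`. -/
noncomputable def doubleRegular (lam mu nu : ℂ) (l m : ℕ) : ℂ :=
  (-1) ^ m * gegenbauerA lam l * gegenbauerA mu m *
    (Complex.Gamma (2 * nu + 1) * Complex.Gamma (lam + mu + 2 * nu + 1) * (2 ^ (2 * nu))⁻¹ *
      ((Complex.Gamma (nu + 1 - (l + m) / 2))⁻¹ * (Complex.Gamma (nu + 1 + lam + (l - m) / 2))⁻¹ *
        (Complex.Gamma (nu + 1 + mu + (m - l) / 2))⁻¹ *
        (Complex.Gamma (nu + 1 + lam + mu + (l + m) / 2))⁻¹))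

/-- The integral of `(s - t)^N C_l^lam(s) C_m^mu(t)` against the product of the weights, expanded
by the binomial theorem. -/
noncomputable def binomialMoment (lam mu : ℂ) (l m N : ℕ) : ℂ :=
  ∑ p ∈ Finset.HasAntidiagonal.antidiagonal N, (N.choose p.1 : ℂ) * (-1) ^ p.2 *
    (gegenbauerIntegral lam (X ^ p.1 * gegenbauerC lam l) *
      gegenbauerIntegral mu (X ^ p.2 * gegenbauerC mu m))

theorem binomialMoment_eq_zero {lam mu : ℂ} (hlam : -1 / 2 < lam.re) (hmu : -1 / 2 < mu.re)
    {l m N : ℕ} (h : ∀ K, N ≠ l + m + 2 * K) : binomialMoment lam mu l m N = 0 := by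
  refine Finset.sum_eq_zero fun p hp => ?_
  rw [Finset.HasAntidiagonal.mem_antidiagonal] at hp
  by_cases h1 : ∃ i, p.1 = l + 2 * i
  · by_cases h2 : ∃ k, p.2 = m + 2 * k
    · obtain ⟨i, hi⟩ := h1
      obtain ⟨k, hk⟩ := h2
      exact absurd (by omega) (h (i + k))
    · push Not at h2
      rw [gegenbauerIntegral_X_pow_mul_gegenbauerC_eq_zero hmu h2]; simp
  · push Not at h1
    rw [gegenbauerIntegral_X_pow_mul_gegenbauerC_eq_zero hlam h1]; simp

/-- Only the terms `(l + 2i, m + 2k)` with `i + k = K` survive orthogonality. Their factorials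
cancel the binomial coefficient, leaving Chu-Vandermonde with `a = lam + l`, `b = mu + m`. -/
theorem binomialMoment_add {lam mu : ℂ} (hlam : -1 / 2 < lam.re) (hmu : -1 / 2 < mu.re)
    (l m K : ℕ) : binomialMoment lam mu l m (l + m + 2 * K) =
      doubleRegular lam mu ((l + m + 2 * K : ℕ) / 2) l m := by
  have hl : (0 : ℝ) ≤ l := l.cast_nonneg
  have hm : (0 : ℝ) ≤ m := m.cast_nonneg
  have h1 : binomialMoment lam mu l m (l + m + 2 * K) = ∑ p ∈ Finset.HasAntidiagonal.antidiagonal K,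
      (((l + m + 2 * K).factorial : ℂ) * (-1) ^ m * gegenbauerA lam l * gegenbauerA mu m *
        (2 ^ (l + m + 2 * K))⁻¹) * (((p.1.factorial : ℂ) * p.2.factorial)⁻¹ *
        ((Complex.Gamma (lam + l + p.1 + 1))⁻¹ * (Complex.Gamma (mu + m + p.2 + 1))⁻¹)) := by
    symm
    refine Finset.sum_of_injOn (fun p => (l + 2 * p.1, m + 2 * p.2)) ?_ ?_ ?_ ?_
    · intro p _ q _ hpq
      simp at hpq
      exact Prod.ext hpq.1 hpq.2
    · intro p hp
      simp at hp ⊢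
      omega
    · intro p hp hp'
      rw [Finset.HasAntidiagonal.mem_antidiagonal] at hp
      by_cases h1 : ∃ i, p.1 = l + 2 * i
      · by_cases h2 : ∃ k, p.2 = m + 2 * k
        · obtain ⟨i, hi⟩ := h1
          obtain ⟨k, hk⟩ := h2
          refine absurd ⟨(i, k), ?_, ?_⟩ hp'
          · simp; omega
          · simp [← hi, ← hk]
        · push Not at h2
          rw [gegenbauerIntegral_X_pow_mul_gegenbauerC_eq_zero hmu h2]; simp
      · push Not at h1
        rw [gegenbauerIntegral_X_pow_mul_gegenbauerC_eq_zero hlam h1]; simp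
    · intro p hp
      rw [Finset.HasAntidiagonal.mem_antidiagonal] at hp
      obtain rfl := hp
      simp only
      rw [gegenbauerIntegral_X_pow_mul_gegenbauerC hlam,
        gegenbauerIntegral_X_pow_mul_gegenbauerC hmu]
      have hN : l + m + 2 * (p.1 + p.2) = (l + 2 * p.1) + (m + 2 * p.2) := by ring
      have hc : (((l + 2 * p.1 + (m + 2 * p.2)).choose (l + 2 * p.1) : ℕ) : ℂ) *
          (l + 2 * p.1).factorial * (m + 2 * p.2).factorial =
            (l + 2 * p.1 + (m + 2 * p.2)).factorial := by
        have := Nat.add_choose_mul_factorial_mul_factorial (l + 2 * p.1) (m + 2 * p.2)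
        rw [← Nat.choose_symm_add] at this
        exact_mod_cast this
      have hpow : (2 : ℂ) ^ (l + 2 * p.1 + (m + 2 * p.2)) = 2 ^ l * 4 ^ p.1 * (2 ^ m * 4 ^ p.2) := by
        rw [pow_add, pow_add, pow_add, pow_mul, pow_mul]; norm_num
      have hs : (-1 : ℂ) ^ (m + 2 * p.2) = (-1) ^ m := by rw [pow_add, pow_mul]; simp
      rw [hN, ← hc, hpow, hs]
      simp only [mul_inv, div_eq_mul_inv]
      ring
  rw [h1, ← Finset.mul_sum, sum_antidiagonal_Gamma (by simp; linarith) (by simp; linarith)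
    (by simp; linarith), doubleRegular]
  have hcpow : (2 : ℂ) ^ (2 * (((l + m + 2 * K : ℕ) : ℂ) / 2)) = 2 ^ (l + m + 2 * K) := by
    rw [mul_div_cancel₀ _ two_ne_zero, Complex.cpow_natCast]
  -- With `nu = N / 2`, `N!` is `Γ(2 nu + 1)` and `K!` is `Γ(nu + 1 - (l + m) / 2)`.
  rw [hcpow, ← Complex.Gamma_nat_eq_factorial, ← Complex.Gamma_nat_eq_factorial K]
  simp only [mul_inv]
  push_cast
  rw [show lam + ↑l + (mu + ↑m) + 2 * ↑K + 1 = lam + mu + 2 * ((↑l + ↑m + 2 * ↑K) / 2) + 1 by ring,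
    show (2 * (((l : ℂ) + ↑m + 2 * ↑K) / 2) + 1) = ↑l + ↑m + 2 * ↑K + 1 by ring,
    show ((l : ℂ) + ↑m + 2 * ↑K) / 2 + 1 - (↑l + ↑m) / 2 = K + 1 by ring,
    show ((l : ℂ) + ↑m + 2 * ↑K) / 2 + 1 + lam + (↑l - ↑m) / 2 = lam + l + K + 1 by ring,
    show ((l : ℂ) + ↑m + 2 * ↑K) / 2 + 1 + mu + (↑m - ↑l) / 2 = mu + m + K + 1 by ring,
    show ((l : ℂ) + ↑m + 2 * ↑K) / 2 + 1 + lam + mu + (↑l + ↑m) / 2 =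
      lam + l + (mu + m) + K + 1 by ring]
  ring

theorem binomialMoment_eq_doubleRegular {lam mu : ℂ} (hlam : -1 / 2 < lam.re)
    (hmu : -1 / 2 < mu.re) {l m N : ℕ} (h : Even (l + m + N)) :
    binomialMoment lam mu l m N = doubleRegular lam mu (N / 2) l m := by
  by_cases hK : ∃ K, N = l + m + 2 * K
  · obtain ⟨K, rfl⟩ := hK
    exact binomialMoment_add hlam hmu l m K
  · push Not at hK
    rw [binomialMoment_eq_zero hlam hmu hK]
    obtain ⟨q, hq⟩ := h
    have hlt : N < l + m := by
      by_contra hle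
      exact hK ((N - (l + m)) / 2) (by omega)
    -- From `l + m + N = 2q` and `N < l + m` the argument is `-(q - N - 1)`, a pole, where
    -- `Complex.Gamma` is `0`.
    have hG : Complex.Gamma ((N : ℂ) / 2 + 1 - (l + m) / 2) = 0 := by
      rw [Complex.Gamma_eq_zero_iff]
      refine ⟨q - N - 1, ?_⟩
      have : l + m = 2 * (q - N - 1) + N + 2 := by omega
      have h2 : (l : ℂ) + m = 2 * (q - N - 1 : ℕ) + N + 2 := by exact_mod_cast this
      rw [h2]; ring
    rw [doubleRegular, hG]
    simp

/-! ### Moment functions and Gamma quotients. -/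

/-- `G` is the Mellin-type transform `nu ↦ ∫ g^nu w` of an integrable density `w` along a bounded
nonnegative function `g`. -/
def IsMomentFunction (G : ℂ → ℂ) : Prop :=
  ∃ (X : Type) (_ : MeasurableSpace X) (μ : Measure X) (_ : SFinite μ) (g : X → ℝ) (w : X → ℂ)
    (R : ℝ), Measurable g ∧ Integrable w μ ∧ (∀ᵐ x ∂μ, 0 ≤ g x ∧ g x ≤ R) ∧
      ∀ nu : ℂ, 0 ≤ nu.re → G nu = ∫ x, (g x : ℂ) ^ nu * w x ∂μ

theorem IsMomentFunction.congr {G G' : ℂ → ℂ} (h : IsMomentFunction G)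
    (hG : ∀ nu : ℂ, 0 ≤ nu.re → G' nu = G nu) : IsMomentFunction G' := by
  obtain ⟨X, _, μ, _, g, w, R, hg, hw, hb, h⟩ := h
  exact ⟨X, _, μ, inferInstance, g, w, R, hg, hw, hb, fun nu hnu => (hG nu hnu).trans (h nu hnu)⟩

/-- Fubini on the product space, with `g g'` and `w w'`; powers multiply because the bases are
nonnegative. -/
theorem IsMomentFunction.mul {G G' : ℂ → ℂ} (h : IsMomentFunction G) (h' : IsMomentFunction G') :
    IsMomentFunction fun nu => G nu * G' nu := by
  obtain ⟨X, _, μ, _, g, w, R, hg, hw, hb, h⟩ := h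
  obtain ⟨X', _, μ', _, g', w', R', hg', hw', hb', h'⟩ := h'
  have hbb : ∀ᵐ x ∂(μ.prod μ'), (0 ≤ g x.1 ∧ g x.1 ≤ R) ∧ (0 ≤ g' x.2 ∧ g' x.2 ≤ R') :=
    (Measure.quasiMeasurePreserving_fst.ae hb).and (Measure.quasiMeasurePreserving_snd.ae hb')
  refine ⟨X × X', inferInstance, μ.prod μ', inferInstance, fun x => g x.1 * g' x.2,
    fun x => w x.1 * w' x.2, R * R', by fun_prop, hw.mul_prod hw', ?_, fun nu hnu => ?_⟩
  · filter_upwards [hbb] with x hx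
    exact ⟨mul_nonneg hx.1.1 hx.2.1, mul_le_mul hx.1.2 hx.2.2 hx.2.1 (hx.1.1.trans hx.1.2)⟩
  · beta_reduce
    rw [h nu hnu, h' nu hnu, ← integral_prod_mul]
    refine integral_congr_ae ?_
    filter_upwards [hbb] with x hx
    rw [Complex.ofReal_mul, Complex.mul_cpow_ofReal_nonneg hx.1.1 hx.2.1]
    ring

theorem isMomentFunction_const_mul_cpow (a : ℂ) {c : ℝ} (hc : 0 ≤ c) :
    IsMomentFunction fun nu => a * (c : ℂ) ^ nu :=
  ⟨Unit, inferInstance, Measure.dirac (), inferInstance, fun _ => c, fun _ => a, c,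
    measurable_const, integrable_const _, Filter.Eventually.of_forall fun _ => ⟨hc, le_rfl⟩,
    fun nu _ => by simp [mul_comm]⟩

theorem isMomentFunction_const (a : ℂ) : IsMomentFunction fun _ => a :=
  (isMomentFunction_const_mul_cpow a zero_le_one).congr fun nu _ => by simp

theorem isMomentFunction_betaIntegral {a b : ℂ} (ha : 0 < a.re) (hb : 0 < b.re) :
    IsMomentFunction fun nu => Complex.betaIntegral (nu + a) b := by
  refine ⟨ℝ, inferInstance, volume.restrict (Set.Ioc 0 1), inferInstance, fun x => x,
    fun x => (x : ℂ) ^ (a - 1) * (1 - (x : ℂ)) ^ (b - 1), 1, measurable_id,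
    (intervalIntegrable_iff_integrableOn_Ioc_of_le zero_le_one).1
      (Complex.betaIntegral_convergent ha hb), ?_, fun nu hnu => ?_⟩
  · filter_upwards [ae_restrict_mem measurableSet_Ioc] with x hx
    exact ⟨hx.1.le, hx.2⟩
  · beta_reduce
    rw [Complex.betaIntegral, intervalIntegral.integral_of_le zero_le_one]
    refine setIntegral_congr_fun measurableSet_Ioc fun x hx => ?_
    have hx0 : (x : ℂ) ≠ 0 := by exact_mod_cast hx.1.ne'
    rw [← mul_assoc, ← Complex.cpow_add _ _ hx0, add_sub_assoc]

/-- The quotient is `B(nu + a, d - a) / Γ(d - a)`. -/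
theorem isMomentFunction_Gamma_div {a d : ℂ} (ha : 0 < a.re) (hd : a.re < d.re) :
    IsMomentFunction fun nu => Complex.Gamma (nu + a) * (Complex.Gamma (nu + d))⁻¹ := by
  have hb : 0 < (d - a).re := by simpa using hd
  refine ((isMomentFunction_betaIntegral ha hb).mul
    (isMomentFunction_const (Complex.Gamma (d - a))⁻¹)).congr fun nu hnu => ?_
  have h1 : 0 < (nu + a).re := by simp; linarith
  have := Complex.Gamma_ne_zero_of_re_pos hb
  rw [Complex.betaIntegral_eq_Gamma_mul_div _ _ h1 hb, show nu + a + (d - a) = nu + d by ring]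
  field_simp

theorem add_one_ne_zero_of_re_nonneg {nu : ℂ} (h : 0 ≤ nu.re) : nu + 1 ≠ 0 := fun h0 => by
  have := congrArg Complex.re h0
  simp at this
  linarith

/-- Write it as `1 + (d - 1) / (nu + 1)`: a unit mass at `1` plus the constant density `d - 1` on
`(0, 1]`. -/
theorem isMomentFunction_add_div_add_one (d : ℂ) :
    IsMomentFunction fun nu => (nu + d) * (nu + 1)⁻¹ := by
  have hint : ∀ z : ℂ, IntegrableOn (fun _ : ℝ => z) (Set.Ioc 0 1) := fun z => by simp
  have hne : ∀ᵐ x : ℝ ∂(volume.restrict (Set.Ioc (0 : ℝ) 1)), x ≠ 1 :=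
    ae_restrict_of_ae (by simp [ae_iff])
  have hpow : ∀ nu : ℂ, 0 ≤ nu.re → IntegrableOn (fun x : ℝ => (x : ℂ) ^ nu) (Set.Ioc 0 1) :=
    fun nu hnu => (intervalIntegrable_iff_integrableOn_Ioc_of_le zero_le_one).1
      (intervalIntegral.intervalIntegrable_cpow' (by linarith))
  refine ⟨ℝ, inferInstance, volume.restrict (Set.Ioc 0 1) + Measure.dirac 1, inferInstance,
    fun x => x, fun x => if x = 1 then 1 else d - 1, 1, measurable_id, ?_, ?_, fun nu hnu => ?_⟩
  · refine Integrable.add_measure ?_ (integrable_dirac (by simp))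
    refine (hint (d - 1)).congr ?_
    filter_upwards [hne] with x hx
    rw [if_neg hx]
  · rw [ae_add_measure_iff]
    constructor
    · filter_upwards [ae_restrict_mem measurableSet_Ioc] with x hx
      exact ⟨hx.1.le, hx.2⟩
    · rw [ae_dirac_iff (measurableSet_Icc (a := (0 : ℝ)) (b := 1))]
      norm_num
  · have hae : (fun x : ℝ => (x : ℂ) ^ nu * (if x = 1 then 1 else d - 1))
        =ᵐ[volume.restrict (Set.Ioc (0 : ℝ) 1)] fun x => (x : ℂ) ^ nu * (d - 1) := by
      filter_upwards [hne] with x hx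
      rw [if_neg hx]
    rw [integral_add_measure ((Integrable.mul_const (hpow nu hnu) _).congr hae.symm)
      (integrable_dirac (by simp)), integral_congr_ae hae, integral_dirac, integral_mul_const,
      ← intervalIntegral.integral_of_le zero_le_one, integral_cpow (Or.inl (by linarith))]
    have := add_one_ne_zero_of_re_nonneg hnu
    simp [Complex.zero_cpow this]
    field_simp
    ring

theorem isMomentFunction_ascPochhammer_div (d : ℂ) (p : ℕ) :
    IsMomentFunction fun nu => (ascPochhammer ℂ p).eval (nu + d) * ((nu + 1) ^ p)⁻¹ := by
  induction p with
  | zero => simpa using isMomentFunction_const 1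
  | succ p ih =>
    refine (ih.mul (isMomentFunction_add_div_add_one (d + p))).congr fun nu _ => ?_
    rw [ascPochhammer_succ_eval, pow_succ, mul_inv]
    ring

theorem one_div_Gamma_eq_ascPochhammer_mul (z : ℂ) (p : ℕ) :
    (Complex.Gamma z)⁻¹ = (ascPochhammer ℂ p).eval z * (Complex.Gamma (z + p))⁻¹ := by
  induction p with
  | zero => simp
  | succ p ih =>
    rw [ih, Complex.one_div_Gamma_eq_self_mul_one_div_Gamma_add_one (z + p), ascPochhammer_succ_eval]
    push_cast
    rw [add_assoc z]
    ring

/-- Shifting `d` by a large `p` makes the Beta integral converge. The shift costs a polynomial of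
degree `p` in `nu`, which the power of `nu + 1` compensates. -/
theorem exists_isMomentFunction_Gamma_div {a : ℂ} (ha : 0 < a.re) (d : ℂ) :
    ∃ p : ℕ, IsMomentFunction fun nu =>
      Complex.Gamma (nu + a) * (Complex.Gamma (nu + d))⁻¹ * ((nu + 1) ^ p)⁻¹ := by
  obtain ⟨p, hp⟩ := exists_nat_gt (a.re - d.re)
  refine ⟨p, ((isMomentFunction_ascPochhammer_div d p).mul
    (isMomentFunction_Gamma_div (d := d + p) ha (by simp; linarith))).congr fun nu _ => ?_⟩
  rw [one_div_Gamma_eq_ascPochhammer_mul (nu + d) p, add_assoc nu d]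
  ring

/-! ### Uniqueness from half-integer values. -/

/-- Put `y = √g`: then `y^(2 nu)` integrates to `G nu` and `y^j` to `G (j / 2)`, so a uniform bound
on `y` integrates to the estimate with `A = ∫ ‖w‖`. -/
theorem IsMomentFunction.exists_norm_sub_sum_le {G : ℂ → ℂ} (h : IsMomentFunction G) :
    ∃ R A : ℝ, ∀ R' ≥ R, ∀ (e : ℕ) (P : ℂ[X]) (nu : ℂ) (δ : ℝ), 0 < nu.re →
      (∀ y ∈ Set.Icc (0 : ℝ) R',
        ‖(y : ℂ) ^ (2 * nu) - (P.eval (y : ℂ) + (-1) ^ e * P.eval (-(y : ℂ)))‖ ≤ δ) →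
      ‖G nu - ∑ j ∈ Finset.range (P.natDegree + 1), P.coeff j * ((1 + (-1) ^ (e + j)) * G (j / 2))‖
        ≤ δ * A := by
  obtain ⟨X, _, μ, _, g, w, R, hg, hw, hb, h⟩ := h
  refine ⟨Real.sqrt R, ∫ x, ‖w x‖ ∂μ, fun R' hR' e P nu δ hnu hP => ?_⟩
  have hpow : ∀ᵐ x ∂μ, ∀ z : ℂ, (g x : ℂ) ^ z = (Real.sqrt (g x) : ℂ) ^ (2 * z) := by
    filter_upwards [hb] with x hx z
    have : (g x : ℂ) = Real.sqrt (g x) * Real.sqrt (g x) := by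
      exact_mod_cast (Real.mul_self_sqrt hx.1).symm
    conv_lhs => rw [this]
    rw [Complex.mul_cpow_ofReal_nonneg (Real.sqrt_nonneg _) (Real.sqrt_nonneg _),
      Complex.cpow_ofNat_mul, sq]
  have hint : ∀ z : ℂ, 0 ≤ z.re → Integrable (fun x => (g x : ℂ) ^ z * w x) μ := by
    intro z hz
    -- The `1` covers `0 ^ 0 = 1` where `g` vanishes.
    refine hw.bdd_mul (c := max 1 (R ^ z.re)) (Measurable.aestronglyMeasurable (by fun_prop)) ?_
    filter_upwards [hb] with x hx
    obtain h0 | h0 := hx.1.eq_or_lt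
    · rw [← h0, Complex.ofReal_zero]
      by_cases hz0 : z = 0
      · simp [hz0]
      · simp [Complex.zero_cpow hz0]
    · rw [Complex.norm_cpow_eq_rpow_re_of_pos h0]
      exact (Real.rpow_le_rpow hx.1 hx.2 hz).trans (le_max_right _ _)
  have hj : ∀ j : ℕ, 0 ≤ ((j : ℂ) / 2).re := fun j => by
    have : (j : ℂ) / 2 = ((j / 2 : ℝ) : ℂ) := by push_cast; rfl
    rw [this, Complex.ofReal_re]; positivity
  have hsum : G nu - ∑ j ∈ Finset.range (P.natDegree + 1),
      P.coeff j * ((1 + (-1) ^ (e + j)) * G (j / 2)) =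
      ∫ x, ((Real.sqrt (g x) : ℂ) ^ (2 * nu) - (P.eval (Real.sqrt (g x) : ℂ) +
        (-1) ^ e * P.eval (-(Real.sqrt (g x) : ℂ)))) * w x ∂μ := by
    have h1 : ∀ j : ℕ, Integrable (fun x => P.coeff j * ((1 + (-1) ^ (e + j)) *
        ((g x : ℂ) ^ ((j : ℂ) / 2) * w x))) μ := fun j => ((hint _ (hj j)).const_mul _).const_mul _
    rw [h nu hnu.le]
    simp_rw [fun j : ℕ => h _ (hj j), ← integral_const_mul]
    rw [← integral_finsetSum _ fun j _ => h1 j,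
      ← integral_sub (hint nu hnu.le) (integrable_finsetSum _ fun j _ => h1 j)]
    refine integral_congr_ae ?_
    filter_upwards [hpow] with x hx
    rw [hx nu, sub_mul, eval_eq_sum_range, eval_eq_sum_range, Finset.mul_sum,
      ← Finset.sum_add_distrib, Finset.sum_mul]
    congr 1
    refine Finset.sum_congr rfl fun j _ => ?_
    rw [hx, mul_div_cancel₀ _ two_ne_zero, Complex.cpow_natCast, neg_pow (Real.sqrt (g x) : ℂ),
      pow_add]
    ring
  rw [hsum, ← integral_const_mul]
  refine norm_integral_le_of_norm_le (hw.norm.const_mul δ) ?_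
  filter_upwards [hb] with x hx
  rw [norm_mul]
  exact mul_le_mul_of_nonneg_right (hP _ ⟨Real.sqrt_nonneg _,
    (Real.sqrt_le_sqrt hx.2).trans hR'⟩) (norm_nonneg _)

theorem exists_complex_polynomial_near (a b : ℝ) (f : ℝ → ℂ) (hf : ContinuousOn f (Set.Icc a b))
    {δ : ℝ} (hδ : 0 < δ) : ∃ P : ℂ[X], ∀ x ∈ Set.Icc a b, ‖P.eval (x : ℂ) - f x‖ ≤ 2 * δ := by
  obtain ⟨p, hp⟩ := exists_polynomial_near_of_continuousOn a b (fun x => (f x).re)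
    (Complex.continuous_re.comp_continuousOn hf) δ hδ
  obtain ⟨q, hq⟩ := exists_polynomial_near_of_continuousOn a b (fun x => (f x).im)
    (Complex.continuous_im.comp_continuousOn hf) δ hδ
  have hev : ∀ (r : ℝ[X]) (x : ℝ), (r.map (algebraMap ℝ ℂ)).eval (x : ℂ) = ((r.eval x : ℝ) : ℂ) :=
    fun r x => by
      have := eval_map_algebraMap r (x : ℂ)
      rw [this]
      simpa using aeval_algebraMap_apply ℂ x r
  refine ⟨p.map (algebraMap ℝ ℂ) + C Complex.I * q.map (algebraMap ℝ ℂ), fun x hx => ?_⟩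
  rw [eval_add, eval_mul, eval_C, hev, hev]
  refine (Complex.norm_le_abs_re_add_abs_im _).trans ?_
  have h1 := hp x hx
  have h2 := hq x hx
  simp at h1 h2 ⊢
  linarith

/-- A moment function is determined on the right half-plane by its values at `n + e / 2`,
`n ∈ ℕ`, where `e` is `0` or `1`. -/
theorem IsMomentFunction.eq_of_eq_half_nat {G G' : ℂ → ℂ} (h : IsMomentFunction G)
    (h' : IsMomentFunction G') {e : ℕ} (heq : ∀ N : ℕ, Even (e + N) → G (N / 2) = G' (N / 2))
    {nu : ℂ} (hnu : 0 < nu.re) : G nu = G' nu := by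
  obtain ⟨R, A, hR⟩ := h.exists_norm_sub_sum_le
  obtain ⟨R', A', hR'⟩ := h'.exists_norm_sub_sum_le
  have hre : 0 < (2 * nu).re := by simpa using hnu
  set S := max R R'
  -- Extend `y^(2 nu)` by zero to negative `y` and approximate by `P` on `[-S, S]`. Then `P(y) +
  -- (-1)^e P(-y)` still approximates it on `[0, S]` but contains only powers of the parity of `e`.
  have hf : Continuous fun x : ℝ => ((max x 0 : ℝ) : ℂ) ^ (2 * nu) :=
    (Complex.continuous_ofReal_cpow_const hre).comp (by fun_prop)
  have key : ∀ δ : ℝ, 0 < δ → ‖G nu - G' nu‖ ≤ δ * (4 * (A + A')) := by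
    intro δ hδ
    obtain ⟨P, hP⟩ := exists_complex_polynomial_near (-S) S _ hf.continuousOn hδ
    have happ : ∀ y ∈ Set.Icc (0 : ℝ) S,
        ‖(y : ℂ) ^ (2 * nu) - (P.eval (y : ℂ) + (-1) ^ e * P.eval (-(y : ℂ)))‖ ≤ 4 * δ := by
      intro y hy
      have h1 := hP y ⟨by linarith [hy.1, hy.2], hy.2⟩
      have h2 := hP (-y) ⟨by linarith [hy.2], by linarith [hy.1, hy.2]⟩
      rw [max_eq_left hy.1] at h1
      rw [max_eq_right (by linarith [hy.1]), Complex.ofReal_zero,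
        Complex.zero_cpow (fun h0 => by rw [h0] at hre; simp at hre), sub_zero] at h2
      calc _ = ‖-(P.eval (y : ℂ) - (y : ℂ) ^ (2 * nu)) - (-1) ^ e * P.eval (-(y : ℂ))‖ := by
            congr 1; ring
        _ ≤ ‖P.eval (y : ℂ) - (y : ℂ) ^ (2 * nu)‖ + ‖P.eval (-(y : ℂ))‖ := by
            refine (norm_sub_le _ _).trans ?_
            rw [norm_neg, norm_mul, norm_pow, norm_neg, norm_one, one_pow, one_mul]
        _ ≤ 4 * δ := by
            push_cast at h2
            linarith
    have h1 := hR S (le_max_left _ _) e P nu (4 * δ) hnu happ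
    have h2 := hR' S (le_max_right _ _) e P nu (4 * δ) hnu happ
    have hs : ∑ j ∈ Finset.range (P.natDegree + 1), P.coeff j * ((1 + (-1) ^ (e + j)) * G (j / 2)) =
        ∑ j ∈ Finset.range (P.natDegree + 1), P.coeff j * ((1 + (-1) ^ (e + j)) * G' (j / 2)) := by
      refine Finset.sum_congr rfl fun j _ => ?_
      obtain hj | hj := Nat.even_or_odd (e + j)
      · rw [heq j hj]
      · rw [hj.neg_one_pow]; simp
    rw [hs] at h1
    calc _ ≤ _ := norm_sub_le_norm_sub_add_norm_sub _ (∑ j ∈ Finset.range (P.natDegree + 1),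
          P.coeff j * ((1 + (-1) ^ (e + j)) * G' (j / 2))) _
      _ ≤ δ * (4 * (A + A')) := by
        rw [norm_sub_rev _ (G' nu)]
        linarith
  have hlim : Filter.Tendsto (fun δ : ℝ => δ * (4 * (A + A'))) (𝓝[>] 0) (𝓝 0) := by
    have : Filter.Tendsto (fun δ : ℝ => δ * (4 * (A + A'))) (𝓝 0) (𝓝 (0 * (4 * (A + A')))) :=
      (continuous_id.mul continuous_const).tendsto 0
    rw [zero_mul] at this
    exact this.mono_left nhdsWithin_le_nhds
  have := ge_of_tendsto hlim (b := ‖G nu - G' nu‖) (by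
    filter_upwards [self_mem_nhdsWithin] with δ hδ using key δ hδ)
  exact sub_eq_zero.1 (norm_eq_zero.1 (le_antisymm this (norm_nonneg _)))

/-! ### The closed form as a moment function. -/

/-- Duplication splits the two numerator Gammas in `nu` into four of the form `Γ(nu + a)` with `Re a
> 0`, one for each reciprocal Gamma. The leftover exponential is `4^nu 4^nu / 2^(2 nu) = 4^nu`, the
moment of a point mass at `4`. -/
theorem exists_isMomentFunction_doubleRegular {lam mu : ℂ} (hlam : -1 / 2 < lam.re)
    (hmu : -1 / 2 < mu.re) (l m : ℕ) :
    ∃ p : ℕ, IsMomentFunction fun nu => doubleRegular lam mu nu l m * ((nu + 1) ^ p)⁻¹ := by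
  have hre1 : 0 < ((lam + mu + 1) / 2).re := by
    have : ((lam + mu + 1) / 2).re = (lam.re + mu.re + 1) / 2 := by simp
    rw [this]; linarith
  have hre2 : 0 < ((lam + mu) / 2 + 1).re := by
    have : ((lam + mu) / 2 + 1).re = (lam.re + mu.re) / 2 + 1 := by simp
    rw [this]; linarith
  obtain ⟨p1, h1⟩ := exists_isMomentFunction_Gamma_div (a := 1 / 2) (by norm_num)
    (1 - (l + m) / 2)
  obtain ⟨p2, h2⟩ := exists_isMomentFunction_Gamma_div (a := 1) (by simp)
    (1 + lam + (l - m) / 2)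
  obtain ⟨p3, h3⟩ := exists_isMomentFunction_Gamma_div hre1 (1 + mu + (m - l) / 2)
  obtain ⟨p4, h4⟩ := exists_isMomentFunction_Gamma_div hre2 (1 + lam + mu + (l + m) / 2)
  refine ⟨p1 + p2 + p3 + p4, ((((h1.mul h2).mul h3).mul h4).mul (isMomentFunction_const_mul_cpow
    ((-1) ^ m * gegenbauerA lam l * gegenbauerA mu m * (4 ^ ((lam + mu) / 2) / Real.pi))
    (c := 4) (by norm_num))).congr fun nu _ => ?_⟩
  have hpi : (Real.sqrt Real.pi : ℂ) ≠ 0 := by exact_mod_cast (Real.sqrt_pos.2 Real.pi_pos).ne'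
  have hpi2 : (Real.pi : ℂ) = Real.sqrt Real.pi * Real.sqrt Real.pi := by
    exact_mod_cast (Real.mul_self_sqrt Real.pi_pos.le).symm
  have e1 : Complex.Gamma (2 * nu + 1) =
      4 ^ nu * Complex.Gamma (nu + 1 / 2) * Complex.Gamma (nu + 1) * (Real.sqrt Real.pi : ℂ)⁻¹ := by
    rw [← Gamma_mul_cpow_duplication, mul_inv_cancel_right₀ hpi]
  have e2 : Complex.Gamma (lam + mu + 2 * nu + 1) = 4 ^ nu * 4 ^ ((lam + mu) / 2) *
      Complex.Gamma (nu + (lam + mu + 1) / 2) * Complex.Gamma (nu + ((lam + mu) / 2 + 1)) *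
        (Real.sqrt Real.pi : ℂ)⁻¹ := by
    have := Gamma_mul_cpow_duplication (nu + (lam + mu) / 2)
    rw [show 2 * (nu + (lam + mu) / 2) + 1 = lam + mu + 2 * nu + 1 by ring,
      Complex.cpow_add _ _ (by norm_num),
      show nu + (lam + mu) / 2 + 1 / 2 = nu + (lam + mu + 1) / 2 by ring, add_assoc nu] at this
    rw [← this, mul_inv_cancel_right₀ hpi]
  have e3 : (2 : ℂ) ^ (2 * nu) = 4 ^ nu := by
    rw [Complex.cpow_ofNat_mul, show (4 : ℂ) = ((2 : ℝ) : ℂ) * ((2 : ℝ) : ℂ) by norm_num,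
      Complex.mul_cpow_ofReal_nonneg (by norm_num) (by norm_num), sq]
    norm_num
  have e4 : (4 : ℂ) ^ nu ≠ 0 := by simp [Complex.cpow_eq_zero_iff]
  have e5 : (4 : ℂ) ^ nu * 4 ^ nu * (4 ^ nu)⁻¹ = 4 ^ nu := mul_inv_cancel_right₀ e4 _
  rw [doubleRegular, e1, e2, e3, hpi2, Complex.ofReal_ofNat,
    show nu + (1 - ((l : ℂ) + m) / 2) = nu + 1 - (l + m) / 2 by ring,
    show nu + (1 + lam + ((l : ℂ) - m) / 2) = nu + 1 + lam + (l - m) / 2 by ring,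
    show nu + (1 + mu + ((m : ℂ) - l) / 2) = nu + 1 + mu + (m - l) / 2 by ring,
    show nu + (1 + lam + mu + ((l : ℂ) + m) / 2) = nu + 1 + lam + mu + (l + m) / 2 by ring,
    div_eq_mul_inv (4 ^ ((lam + mu) / 2) : ℂ), mul_inv (Real.sqrt Real.pi : ℂ)]
  simp only [pow_add (nu + 1), mul_inv ((nu + 1) ^ p1 * (nu + 1) ^ p2 * (nu + 1) ^ p3),
    mul_inv ((nu + 1) ^ p1 * (nu + 1) ^ p2), mul_inv ((nu + 1) ^ p1)]
  generalize (4 : ℂ) ^ nu = z at *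
  have e6 : z * z * z⁻¹ = z := e5
  rw [show ∀ a b c d : ℂ, (z * a * b * (Real.sqrt Real.pi : ℂ)⁻¹) * (z * 4 ^ ((lam + mu) / 2) * c * d *
    (Real.sqrt Real.pi : ℂ)⁻¹) * z⁻¹ = z * z * z⁻¹ * (a * b * c * d * 4 ^ ((lam + mu) / 2) *
    ((Real.sqrt Real.pi : ℂ)⁻¹ * (Real.sqrt Real.pi : ℂ)⁻¹)) from fun a b c d => by ring, e6]
  ring

/-! ### The double integral. -/

/-- The restriction of the product Lebesgue measure to the square `(-1, 1]²`. -/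
noncomputable abbrev squareMeasure : Measure (ℝ × ℝ) :=
  (volume.restrict (Set.Ioc (-1 : ℝ) 1)).prod (volume.restrict (Set.Ioc (-1 : ℝ) 1))

theorem ae_squareMeasure_mem :
    ∀ᵐ p ∂squareMeasure, p.1 ∈ Set.Ioc (-1 : ℝ) 1 ∧ p.2 ∈ Set.Ioc (-1 : ℝ) 1 :=
  (Measure.quasiMeasurePreserving_fst.ae (ae_restrict_mem measurableSet_Ioc)).and
    (Measure.quasiMeasurePreserving_snd.ae (ae_restrict_mem measurableSet_Ioc))

theorem integrableOn_eval_mul_gegenbauerWeight {lam : ℂ} (hlam : -1 / 2 < lam.re) (p : ℂ[X]) :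
    Integrable (fun s : ℝ => p.eval (s : ℂ) * gegenbauerWeight lam s)
      (volume.restrict (Set.Ioc (-1 : ℝ) 1)) :=
  (intervalIntegrable_iff_integrableOn_Ioc_of_le (by norm_num)).1
    (intervalIntegrable_mul_gegenbauerWeight hlam p)

theorem integral_squareMeasure_mul {lam mu : ℂ} (p q : ℂ[X]) :
    ∫ x, (p.eval (x.1 : ℂ) * gegenbauerWeight lam x.1) * (q.eval (x.2 : ℂ) * gegenbauerWeight mu x.2)
      ∂squareMeasure = gegenbauerIntegral lam p * gegenbauerIntegral mu q := by
  rw [gegenbauerIntegral, gegenbauerIntegral, intervalIntegral.integral_of_le (by norm_num),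
    intervalIntegral.integral_of_le (by norm_num)]
  exact integral_prod_mul (fun s : ℝ => p.eval (s : ℂ) * gegenbauerWeight lam s)
    (fun t : ℝ => q.eval (t : ℂ) * gegenbauerWeight mu t)

theorem doubleIntegrand_eq (e : ℕ) (lam mu nu : ℂ) (l m : ℕ) (s t : ℝ) :
    doubleIntegrand e lam mu nu l m s t = (((s - t) ^ 2 : ℝ) : ℂ) ^ nu *
      (((Real.sign (s - t) ^ e : ℝ) : ℂ) *
        (((gegenbauerC lam l).eval (s : ℂ) * gegenbauerWeight lam s) *
          ((gegenbauerC mu m).eval (t : ℂ) * gegenbauerWeight mu t))) := by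
  have h : (((s - t) ^ 2 : ℝ) : ℂ) ^ nu = ((|s - t| : ℝ) : ℂ) ^ (2 * nu) := by
    rw [← sq_abs, sq, Complex.ofReal_mul,
      Complex.mul_cpow_ofReal_nonneg (abs_nonneg _) (abs_nonneg _), Complex.cpow_ofNat_mul, sq]
  rw [h, doubleIntegrand, gegenbauerWeight, gegenbauerWeight]
  ring

theorem norm_sign_pow_le (x : ℝ) (e : ℕ) : ‖((Real.sign x ^ e : ℝ) : ℂ)‖ ≤ 1 := by
  rw [Complex.norm_real, norm_pow]
  refine pow_le_one₀ (norm_nonneg _) ?_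
  obtain h | h | h := Real.sign_apply_eq x <;> simp [h]

theorem measurable_real_sign : Measurable Real.sign :=
  Measurable.ite measurableSet_Iio measurable_const
    (Measurable.ite measurableSet_Ioi measurable_const measurable_const)

theorem integrable_sign_mul {lam mu : ℂ} (hlam : -1 / 2 < lam.re) (hmu : -1 / 2 < mu.re)
    (e l m : ℕ) : Integrable (fun p : ℝ × ℝ => ((Real.sign (p.1 - p.2) ^ e : ℝ) : ℂ) *
        (((gegenbauerC lam l).eval (p.1 : ℂ) * gegenbauerWeight lam p.1) *
          ((gegenbauerC mu m).eval (p.2 : ℂ) * gegenbauerWeight mu p.2))) squareMeasure := by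
  have := measurable_real_sign
  exact ((integrableOn_eval_mul_gegenbauerWeight hlam (gegenbauerC lam l)).mul_prod
    (integrableOn_eval_mul_gegenbauerWeight hmu (gegenbauerC mu m))).bdd_mul (c := 1)
    (Measurable.aestronglyMeasurable (by fun_prop))
    (Filter.Eventually.of_forall fun _ => norm_sign_pow_le _ _)

theorem integrable_doubleIntegrand {lam mu nu : ℂ} (hlam : -1 / 2 < lam.re)
    (hmu : -1 / 2 < mu.re) (hnu : 0 < nu.re) (e l m : ℕ) :
    Integrable (fun p : ℝ × ℝ => doubleIntegrand e lam mu nu l m p.1 p.2) squareMeasure := by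
  simp_rw [doubleIntegrand_eq]
  refine (integrable_sign_mul hlam hmu e l m).bdd_mul (c := 4 ^ nu.re)
    (Measurable.aestronglyMeasurable (by fun_prop)) ?_
  filter_upwards [ae_squareMeasure_mem] with p hp
  rw [Complex.norm_cpow_eq_rpow_re_of_nonneg (sq_nonneg _) hnu.ne']
  exact Real.rpow_le_rpow (sq_nonneg _) (by nlinarith [hp.1.1, hp.1.2, hp.2.1, hp.2.2]) hnu.le

theorem isMomentFunction_integral_doubleIntegrand {lam mu : ℂ} (hlam : -1 / 2 < lam.re)
    (hmu : -1 / 2 < mu.re) (e l m : ℕ) :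
    IsMomentFunction fun nu => ∫ p, doubleIntegrand e lam mu nu l m p.1 p.2 ∂squareMeasure := by
  refine ⟨ℝ × ℝ, inferInstance, squareMeasure, inferInstance, fun p => (p.1 - p.2) ^ 2, _, 4,
    by fun_prop, integrable_sign_mul hlam hmu e l m, ?_, fun nu _ => ?_⟩
  · filter_upwards [ae_squareMeasure_mem] with p hp
    exact ⟨sq_nonneg _, by nlinarith [hp.1.1, hp.1.2, hp.2.1, hp.2.2]⟩
  · simp_rw [doubleIntegrand_eq]

theorem abs_pow_mul_sign_pow {e N : ℕ} (he : e = 0 ∨ e = 1) (h : Even (e + N)) (x : ℝ) :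
    |x| ^ N * Real.sign x ^ e = x ^ N := by
  obtain hx | rfl | hx := lt_trichotomy x 0
  · rw [abs_of_neg hx, Real.sign_of_neg hx, neg_pow, mul_right_comm, ← pow_add, add_comm,
      h.neg_one_pow, one_mul]
  -- At `0` the sign is `0`, so `e = 1` needs `N ≠ 0`, which parity supplies; for `e = 0` the sign
  -- factor is `1`.
  · obtain rfl | rfl := he
    · simp
    · have : N ≠ 0 := by rintro rfl; simp at h
      simp [this]
  · rw [abs_of_pos hx, Real.sign_of_pos hx, one_pow, mul_one]

theorem integral_doubleIntegrand_half_nat {lam mu : ℂ} (hlam : -1 / 2 < lam.re)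
    (hmu : -1 / 2 < mu.re) {e N : ℕ} (he : e = 0 ∨ e = 1) (h : Even (e + N)) (l m : ℕ) :
    ∫ p, doubleIntegrand e lam mu (N / 2) l m p.1 p.2 ∂squareMeasure =
      binomialMoment lam mu l m N := by
  have h1 : ∀ p : ℝ × ℝ, doubleIntegrand e lam mu (N / 2) l m p.1 p.2 =
      ∑ q ∈ Finset.HasAntidiagonal.antidiagonal N, (N.choose q.1 : ℂ) * (-1) ^ q.2 *
        (((X ^ q.1 * gegenbauerC lam l).eval (p.1 : ℂ) * gegenbauerWeight lam p.1) *
          ((X ^ q.2 * gegenbauerC mu m).eval (p.2 : ℂ) * gegenbauerWeight mu p.2)) := by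
    intro p
    have h2 : ((|p.1 - p.2| : ℝ) : ℂ) ^ (2 * ((N : ℂ) / 2)) *
        ((Real.sign (p.1 - p.2) ^ e : ℝ) : ℂ) = ((p.1 : ℂ) + -p.2) ^ N := by
      rw [mul_div_cancel₀ _ two_ne_zero, Complex.cpow_natCast, ← Complex.ofReal_pow,
        ← Complex.ofReal_mul, abs_pow_mul_sign_pow he h]
      push_cast
      rw [sub_eq_add_neg]
    rw [doubleIntegrand, h2, (Commute.all _ _).add_pow', Finset.sum_mul, Finset.sum_mul,
      Finset.sum_mul, Finset.sum_mul]
    refine Finset.sum_congr rfl fun q _ => ?_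
    simp only [eval_mul, eval_pow, eval_X, nsmul_eq_mul, gegenbauerWeight]
    rw [neg_pow]
    ring
  simp_rw [h1]
  rw [integral_finsetSum, binomialMoment]
  · refine Finset.sum_congr rfl fun q _ => ?_
    rw [integral_const_mul, integral_squareMeasure_mul]
  · intro q _
    exact ((integrableOn_eval_mul_gegenbauerWeight hlam _).mul_prod
      (integrableOn_eval_mul_gegenbauerWeight hmu _)).const_mul _

theorem integral_doubleIntegrand {lam mu nu : ℂ} (hlam : -1 / 2 < lam.re)
    (hmu : -1 / 2 < mu.re) (hnu : 0 < nu.re) {e : ℕ} (he : e = 0 ∨ e = 1) (l m : ℕ) :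
    ∫ p, doubleIntegrand e lam mu nu l m p.1 p.2 ∂squareMeasure =
      1 / 2 * (1 + (-1 : ℂ) ^ (l + m + e)) * doubleRegular lam mu nu l m := by
  have hJ := isMomentFunction_integral_doubleIntegrand hlam hmu e l m
  obtain hpar | hpar := Nat.even_or_odd (l + m + e)
  · rw [hpar.neg_one_pow]
    obtain ⟨p, hp⟩ := exists_isMomentFunction_doubleRegular hlam hmu l m
    -- The integral must be divided by the same power; `1 / (nu + 1) = Γ(nu + 1) / Γ(nu + 2)`.
    have h1 : IsMomentFunction fun nu => ((nu + 1) ^ p)⁻¹ := by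
      clear hp
      induction p with
      | zero => simpa using isMomentFunction_const 1
      | succ p ih =>
        refine (ih.mul (isMomentFunction_Gamma_div (a := 1) (d := 2) (by simp) (by simp))).congr
          fun nu hnu => ?_
        have h0 := add_one_ne_zero_of_re_nonneg hnu
        have hG := Complex.Gamma_ne_zero_of_re_pos (s := nu + 1) (by simp; linarith)
        rw [show nu + 2 = nu + 1 + 1 by ring, Complex.Gamma_add_one _ h0, pow_succ]
        field_simp
    have := (hJ.mul h1).eq_of_eq_half_nat hp (e := e) (fun N hN => by
      rw [integral_doubleIntegrand_half_nat hlam hmu he hN, binomialMoment_eq_doubleRegular hlam hmu]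
      rw [Nat.even_add] at hpar hN ⊢
      tauto) hnu
    have h0 := pow_ne_zero p (add_one_ne_zero_of_re_nonneg hnu.le)
    rw [mul_right_cancel₀ (inv_ne_zero h0) this]
    ring
  · rw [hpar.neg_one_pow, add_neg_cancel, mul_zero, zero_mul]
    -- If `l + m + e` is odd, an `N` of the parity of `e` is never `l + m + 2K`, so every sampled
    -- value is zero.
    refine hJ.eq_of_eq_half_nat (isMomentFunction_const 0) (e := e) (fun N hN => ?_) hnu
    rw [integral_doubleIntegrand_half_nat hlam hmu he hN, binomialMoment_eq_zero hlam hmu]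
    rintro K rfl
    obtain ⟨a, ha⟩ := hN
    obtain ⟨b, hb⟩ := hpar
    omega

/-! ### Comparison with the stated constants, and continuity. -/

theorem ne_neg_natCast_of_neg_half_lt {lam : ℂ} (hlam : -1 / 2 < lam.re) (h0 : lam ≠ 0) (k : ℕ) :
    lam ≠ -k := by
  obtain _ | k := k
  · simpa using h0
  · intro h
    have h1 := congrArg Complex.re h
    have : (0 : ℝ) ≤ k := k.cast_nonneg
    simp at h1
    linarith

/-- Use `Γ(2 lam + l) = (2 lam)_l Γ(2 lam)`; duplication then cancels `Γ(2 lam)` against `Γ(lam)`.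
-/
theorem gegenbauerV_mul_eq {lam : ℂ} (hlam : -1 / 2 < lam.re) (h0 : lam ≠ 0) (l : ℕ) :
    (lam + l) * Complex.Gamma lam * gegenbauerV lam l = gegenbauerA lam l := by
  have hG := Complex.Gamma_ne_zero (ne_neg_natCast_of_neg_half_lt hlam h0)
  have hl : (l : ℂ) + lam ≠ 0 := fun h =>
    ne_neg_natCast_of_neg_half_lt hlam h0 l (by linear_combination h)
  have h2 : ∀ k : ℕ, 2 * lam ≠ -k := by
    intro k h
    obtain _ | k := k
    · simp [h0] at h
    · have h1 := congrArg Complex.re h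
      have : (0 : ℝ) ≤ k := k.cast_nonneg
      simp at h1
      linarith
  have h3 := Gamma_add_natCast h2 l
  have h4 := Complex.Gamma_mul_Gamma_add_half lam
  have hf : (l.factorial : ℂ) ≠ 0 := by exact_mod_cast l.factorial_ne_zero
  have hpi2 : (Real.pi : ℂ) = Real.sqrt Real.pi * Real.sqrt Real.pi := by
    exact_mod_cast (Real.mul_self_sqrt Real.pi_pos.le).symm
  rw [gegenbauerV, gegenbauerA, add_comm (l : ℂ) (2 * lam), h3, add_comm lam l, hpi2]
  clear h3
  generalize Complex.Gamma (lam + 1 / 2) = x at *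
  generalize Complex.Gamma (2 * lam) = y at *
  generalize (ascPochhammer ℂ l).eval (2 * lam) = z at *
  generalize (2 : ℂ) ^ (1 - 2 * lam) = c at *
  field_simp
  linear_combination -z * h4

theorem doubleValue_eq_doubleRegular (e : ℕ) {lam mu : ℂ} (nu : ℂ) (hlam : -1 / 2 < lam.re)
    (hmu : -1 / 2 < mu.re) (hlam0 : lam ≠ 0) (hmu0 : mu ≠ 0) (l m : ℕ) :
    doubleValue e lam mu nu l m =
      1 / 2 * (1 + (-1 : ℂ) ^ (l + m + e)) * doubleRegular lam mu nu l m := by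
  rw [doubleValue, doubleRegular, ← gegenbauerV_mul_eq hlam hlam0, ← gegenbauerV_mul_eq hmu hmu0,
    coeffB, Finset.prod_pair (by norm_num), Finset.prod_pair (by norm_num),
    Finset.prod_pair (by norm_num)]
  push_cast
  rw [show nu + 1 + (lam + mu) / 2 + 1 * ((lam + l) / 2) + 1 * ((mu + m) / 2) =
      nu + 1 + lam + mu + (l + m) / 2 by ring,
    show nu + 1 + (lam + mu) / 2 + 1 * ((lam + l) / 2) + -1 * ((mu + m) / 2) =
      nu + 1 + lam + (l - m) / 2 by ring,
    show nu + 1 + (lam + mu) / 2 + -1 * ((lam + l) / 2) + 1 * ((mu + m) / 2) =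
      nu + 1 + mu + (m - l) / 2 by ring,
    show nu + 1 + (lam + mu) / 2 + -1 * ((lam + l) / 2) + -1 * ((mu + m) / 2) =
      nu + 1 - (l + m) / 2 by ring]
  ring

/-- The numerator Gammas have arguments of positive real part, and `1 / Γ` is entire. -/
theorem continuousAt_doubleRegular {lam mu nu : ℂ} (hlam : -1 / 2 < lam.re)
    (hmu : -1 / 2 < mu.re) (hnu : 0 < nu.re) (l m : ℕ) :
    ContinuousAt (fun p : ℂ × ℂ => doubleRegular p.1 p.2 nu l m) (lam, mu) := by
  have hGamma : ∀ (f : ℂ × ℂ → ℂ), Continuous f → 0 < (f (lam, mu)).re →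
      ContinuousAt (fun p => Complex.Gamma (f p)) (lam, mu) := fun f hf h =>
    ContinuousAt.comp (f := f) (g := Complex.Gamma) (Complex.differentiableAt_Gamma _
      (ne_neg_natCast_of_re_pos h)).continuousAt hf.continuousAt
  have hinv : ∀ (f : ℂ × ℂ → ℂ), Continuous f →
      ContinuousAt (fun p => (Complex.Gamma (f p))⁻¹) (lam, mu) := fun f hf =>
    (Complex.differentiable_one_div_Gamma.continuous.comp hf).continuousAt
  have hpoch : ∀ (f : ℂ × ℂ → ℂ) (k : ℕ), Continuous f →
      ContinuousAt (fun p => (ascPochhammer ℂ k).eval (2 * f p)) (lam, mu) := fun f k hf =>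
    ((ascPochhammer ℂ k).continuous.comp (continuous_const.mul hf)).continuousAt
  have hA1 : ContinuousAt (fun p : ℂ × ℂ => gegenbauerA p.1 l) (lam, mu) := by
    unfold gegenbauerA
    exact ((continuousAt_const.mul (hpoch _ l continuous_fst)).mul
      (hGamma _ (by fun_prop) (by simp; linarith))).div_const _
  have hA2 : ContinuousAt (fun p : ℂ × ℂ => gegenbauerA p.2 m) (lam, mu) := by
    unfold gegenbauerA
    exact ((continuousAt_const.mul (hpoch _ m continuous_snd)).mul
      (hGamma _ (by fun_prop) (by simp; linarith))).div_const _
  unfold doubleRegular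
  exact ((continuousAt_const.mul hA1).mul hA2).mul (((continuousAt_const.mul
    (hGamma _ (by fun_prop) (by simp; linarith))).mul continuousAt_const).mul
    ((((hinv _ (by fun_prop)).mul (hinv _ (by fun_prop))).mul (hinv _ (by fun_prop))).mul
      (hinv _ (by fun_prop))))

/-! ### The squared norm. -/

/-- Expand one factor: by orthogonality only its leading term contributes. -/
theorem gegenbauerIntegral_gegenbauerC_sq {lam : ℂ} (hlam : -1 / 2 < lam.re) (h0 : lam ≠ 0)
    (n : ℕ) : gegenbauerIntegral lam (gegenbauerC lam n * gegenbauerC lam n) =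
      gegenbauerV lam n := by
  have h1 : gegenbauerIntegral lam (gegenbauerC lam n * gegenbauerC lam n) =
      (gegenbauerC lam n).coeff n * gegenbauerIntegral lam (X ^ n * gegenbauerC lam n) := by
    conv_lhs => enter [2, 1]; rw [(gegenbauerC lam n).as_sum_range_C_mul_X_pow' (n := n + 1)
      (Nat.lt_succ_of_le (natDegree_gegenbauerC_le lam n))]
    rw [Finset.sum_mul, gegenbauerIntegral_sum hlam, Finset.sum_eq_single_of_mem n (by simp)]
    · rw [mul_assoc, gegenbauerIntegral_C_mul]
    · intro j hj hjn
      rw [mul_assoc, gegenbauerIntegral_C_mul,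
        gegenbauerIntegral_X_pow_mul_gegenbauerC_eq_zero hlam, mul_zero]
      intro i hi
      simp at hj
      omega
  have hneg := ne_neg_natCast_of_neg_half_lt hlam h0
  have hG := Complex.Gamma_ne_zero hneg
  have hn : lam + n ≠ 0 := fun h => hneg n (by linear_combination h)
  have h2 := gegenbauerIntegral_X_pow_mul_gegenbauerC hlam n 0
  have h3 := Gamma_add_natCast hneg n
  have h4 : Complex.Gamma (lam + n) ≠ 0 := Complex.Gamma_ne_zero fun k h =>
    hneg (n + k) (by push_cast; linear_combination h)
  have hf : (n.factorial : ℂ) ≠ 0 := by exact_mod_cast n.factorial_ne_zero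
  have h5 : (ascPochhammer ℂ n).eval lam = Complex.Gamma (lam + n) / Complex.Gamma lam := by
    rw [h3]; field_simp
  simp only [mul_zero, add_zero, pow_zero, Nat.factorial_zero, Nat.cast_one, Nat.cast_zero,
    mul_one] at h2
  rw [h1, h2, coeff_gegenbauerC_self, ← gegenbauerV_mul_eq hlam h0, Complex.Gamma_add_one _ hn, h5]
  field_simp

theorem gegenbauerC_eval_ofReal (κ : ℝ) (n : ℕ) (x : ℝ) :
    ∃ y : ℝ, (gegenbauerC (κ : ℂ) n).eval (x : ℂ) = y := by
  have h : ∀ k, (ascPochhammer ℂ k).eval (κ : ℂ) = (((ascPochhammer ℝ k).eval κ : ℝ) : ℂ) := by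
    intro k
    induction k with
    | zero => simp
    | succ k ih => rw [ascPochhammer_succ_eval, ascPochhammer_succ_eval, ih]; push_cast; rfl
  refine ⟨∑ k ∈ Finset.range (n / 2 + 1), ((-1 : ℝ) ^ k * (ascPochhammer ℝ (n - k)).eval κ /
        ((k.factorial : ℝ) * ((n - 2 * k).factorial : ℝ))) * (2 * x) ^ (n - 2 * k), ?_⟩
  rw [gegenbauerC, eval_finsetSum]
  push_cast
  refine Finset.sum_congr rfl fun k _ => ?_
  rw [eval_mul, eval_C, eval_pow, eval_mul, eval_X, h]
  simp

theorem integral_norm_gegenbauerC_sq {κ : ℝ} (hκ : -1 / 2 < κ) (h0 : κ ≠ 0) (n : ℕ) :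
    ((∫ x in (-1 : ℝ)..1,
      ‖(gegenbauerC (κ : ℂ) n).eval (x : ℂ)‖ ^ 2 * (1 - x ^ 2) ^ (κ - 1 / 2) : ℝ) : ℂ) =
        gegenbauerV (κ : ℂ) n := by
  rw [← gegenbauerIntegral_gegenbauerC_sq (by simpa using hκ) (by exact_mod_cast h0),
    gegenbauerIntegral, ← intervalIntegral.integral_ofReal]
  refine intervalIntegral.integral_congr fun x hx => ?_
  rw [Set.uIcc_of_le (by norm_num)] at hx
  obtain ⟨y, hy⟩ := gegenbauerC_eval_ofReal κ n x
  simp only [eval_mul, hy, Complex.norm_real, Real.norm_eq_abs, sq_abs, gegenbauerWeight]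
  rw [Complex.ofReal_mul, Complex.ofReal_cpow (by nlinarith [hx.1, hx.2])]
  push_cast
  ring

/-! ### The main theorem. -/

theorem proposition5p2 :
    -- for real parameters, `v` is the squared norm in the weighted `L²` space
    (∀ (κ : ℝ) (n : ℕ), -1 / 2 < κ → κ ≠ 0 →
      ((∫ x in (-1 : ℝ)..1,
          ‖(gegenbauerC (κ : ℂ) n).eval (x : ℂ)‖ ^ 2 * (1 - x ^ 2) ^ (κ - 1 / 2) : ℝ) : ℂ) =
        gegenbauerV (κ : ℂ) n) ∧
    ∀ (ε : ℕ) (_hε : ε = 0 ∨ ε = 1) (l m : ℕ) (lam mu nu : ℂ)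
      (_hlam : -1 / 2 < lam.re) (_hmu : -1 / 2 < mu.re) (_hnu : 0 < nu.re),
      -- the double integral converges absolutely
      MeasureTheory.IntegrableOn
          (fun p : ℝ × ℝ => doubleIntegrand ε lam mu nu l m p.1 p.2)
          (Set.Icc (-1 : ℝ) 1 ×ˢ Set.Icc (-1 : ℝ) 1) MeasureTheory.volume ∧
      -- the formula, where the Gamma factors on the right-hand side are defined
      (lam ≠ 0 → mu ≠ 0 →
        ∫ t in (-1 : ℝ)..1, ∫ s in (-1 : ℝ)..1, doubleIntegrand ε lam mu nu l m s t =
          doubleValue ε lam mu nu l m) ∧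
      -- in general (also for `lam = 0` or `mu = 0`) the right-hand side is read as its limit
      Filter.Tendsto (fun p : ℂ × ℂ => doubleValue ε p.1 p.2 nu l m)
        (𝓝[{p : ℂ × ℂ | p.1 ≠ 0 ∧ p.2 ≠ 0}] (lam, mu))
        (𝓝 (∫ t in (-1 : ℝ)..1, ∫ s in (-1 : ℝ)..1, doubleIntegrand ε lam mu nu l m s t)) := by
  refine ⟨fun κ n hκ h0 => integral_norm_gegenbauerC_sq hκ h0 n,
    fun e he l m lam mu nu hlam hmu hnu => ?_⟩
  have hint := integrable_doubleIntegrand hlam hmu hnu e l m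
  have hval : ∫ t in (-1 : ℝ)..1, ∫ s in (-1 : ℝ)..1, doubleIntegrand e lam mu nu l m s t =
      1 / 2 * (1 + (-1 : ℂ) ^ (l + m + e)) * doubleRegular lam mu nu l m := by
    rw [← integral_doubleIntegrand hlam hmu hnu he, integral_prod_symm _ hint]
    simp_rw [intervalIntegral.integral_of_le (show (-1 : ℝ) ≤ 1 by norm_num)]
  refine ⟨?_, fun hlam0 hmu0 => ?_, ?_⟩
  · rw [IntegrableOn, Measure.volume_eq_prod, ← Measure.prod_restrict,
      ← Measure.restrict_congr_set (Ioc_ae_eq_Icc (a := (-1 : ℝ)) (b := 1) (μ := volume))]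
    exact hint
  · rw [hval, doubleValue_eq_doubleRegular e nu hlam hmu hlam0 hmu0]
  · rw [hval]
    have hc := ((continuousAt_doubleRegular hlam hmu hnu l m).const_mul
      (1 / 2 * (1 + (-1 : ℂ) ^ (l + m + e)))).tendsto.mono_left
      (nhdsWithin_le_nhds (s := {p : ℂ × ℂ | p.1 ≠ 0 ∧ p.2 ≠ 0}))
    refine hc.congr' ?_
    -- The parameter range is open, so near `(lam, mu)` and off the axes the stated value equals the
    -- regular form.
    have hopen : ∀ᶠ p : ℂ × ℂ in 𝓝 (lam, mu), -1 / 2 < p.1.re ∧ -1 / 2 < p.2.re :=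
      ((Complex.continuous_re.comp continuous_fst).tendsto (lam, mu) |>.eventually_const_lt hlam).and
        ((Complex.continuous_re.comp continuous_snd).tendsto (lam, mu) |>.eventually_const_lt hmu)
    filter_upwards [self_mem_nhdsWithin, nhdsWithin_le_nhds hopen] with p hp0 hp
    rw [doubleValue_eq_doubleRegular e nu hp.1 hp.2 hp0.1 hp0.2]
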